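/- **Conventions.** For a semi-Riemannian manifold $(M,g)$ with Levi-Civita connection $\nabla$ let $R(X,Y)Z=\nabla_X\nabla_YZ-\nabla_Y\nabla_XZ-\nabla_{[X,Y]}Z$, $R_{ijkl}=g(R(\partial_i,\partial_j)\partial_k,\partial_l)$, $S_{jk}=g^{il}R_{ijkl}$ (Ricci tensor) and $\kappa=g^{jk}S_{jk}$; for $(0,2)$-tensors let $(A\wedge E)_{ijkl}=A_{il}E_{jk}+A_{jk}E_{il}-A_{ik}E_{jl}-A_{jl}E_{ik}$. Let $U_M$ be the set of points of $M$ at which $\nabla R\neq\xi\otimes R$ for every covector $\xi$. For smooth 1-forms $\Pi,\Phi,\Psi,\Theta$ consider the identities $$(H)\quad \nabla R=\Pi\otimes R+\Psi\otimes g\wedge S,\qquad (G)\quad \nabla R=\Pi\otimes R+\Phi\otimes S\wedge S+\Psi\otimes g\wedge S+\Theta\otimes g\wedge g .$$ $M$ is hyper generalized recurrent, $HGK$, with $(\Pi,\Psi)$ if $(H)$ holds on $U_M$; it is super generalized recurrent, $SGK$, with $(\Pi,\Phi,\Psi,\Theta)$ if $(G)$ holds on $U_M$. Let $\overline M$ and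 $\widetilde M\neq\emptyset$ be smooth manifolds of dimensions $p\ge1$ and $n-p\ge1$ with semi-Riemannian metrics $\overline g$, $\widetilde g$, let $f>0$ be a smooth function on $\overline M$, and let $M=\overline M\times_f\widetilde M$ be $\overline M\times\widetilde M$ with the metric $g=\pi^*\overline g+(f\circ\pi)\,\sigma^*\widetilde g$, where $\pi,\sigma$ are the projections. Bars and tildes denote objects of $\overline M$ and $\widetilde M$; for a 1-form $\Pi$ on $M$, $\overline\Pi$ and $\widetilde\Pi$ are its restrictions to the slices $\overline M\times\{y\}$ and $\{x\}\times\widetilde M$. On $\overline M$ put $$T_{ab}=\tfrac1{2f}\Big(\overline\nabla_bf_a-\tfrac1{2f}f_af_b\Big),\quad P=\tfrac1{4f^2}\overline g^{ab}f_af_b,\quad Q=-f\big((n-p-1)P+\overline g^{ab}T_{ab}\big),$$ so that $R_{a\alpha b\beta}=fT_{ab}\widetilde g_{\alpha\beta}$ and $S_{\alpha\beta}=\widetilde S_{\alpha\beta}+Q\widetilde g_{\alpha\beta}$ for base indices $a,b$ and fiber indices $\alpha,\beta$. **Statement.** Let $M=\overline M\times_f\widetilde M$ be $HGK$ with $(\Pi,\Psi)$,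 and let $V\supseteq U_M$ be the set of all points of $M$ at which $(H)$ holds. (i) If $T$ and $\overline S$ are linearly dependent, in the sense that $T=\lambda\overline S$ for some smooth function $\lambda$ on $\overline M$ or that $\overline S$ vanishes identically, then $\overline M$ is $HGK$ with some smooth 1-forms $(\Pi',\Psi')$, which can be chosen so that, if $V=M$, the identity $(H)$ for $\overline M$ holds at every point of $\overline M$. (ii) For every $x\in\overline M$, $\widetilde M$ is $SGK$ with $(\widetilde\Pi,\,0,\,\widetilde\Psi,\,-\tfrac12fP\,\widetilde\Pi+Q\,\widetilde\Psi)$, where $f,P,Q$ are evaluated at $x$ and $\widetilde\Pi,\widetilde\Psi$ are restricted to $\{x\}\times\widetilde M$; moreover $(G)$ with these forms holds at every $y\in\widetilde M$ with $(x,y)\in V$. (iii) If $n-p\ge3$, the conformal curvature tensor of $\widetilde M$ vanishes at $y$ whenever $(x,y)\in V$ and $df+f\overline\Pi\neq0$ at $(x,y)$. (iv) The Einstein condition $\widetilde S=\frac{\widetilde\kappa}{n-p}\widetilde g$ holds at $y$ whenever $(x,y)\in V$ and $\Psi\neq0$ at $(x,y)$. If $df\neq0$ at some point of $\overline M$, then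 $\widetilde M$ is of constant curvature: $\widetilde R=\frac c2\,\widetilde g\wedge\widetilde g$ on all of $\widetilde M$ for some constant $c\in\mathbb R$. -/

import Mathlib

open scoped Manifold ContDiff

/-! ### Local tensor calculus

A semi-Riemannian metric on an open subset of a finite-dimensional normed space `E` with a basis
`b` is given by its component matrix `G : E → Matrix ι ι ℝ`.  The point is always called `u`. -/

namespace LocalGeom

noncomputable section

variable {E : Type*} [NormedAddCommGroup E] [NormedSpace ℝ E]
variable {ι : Type*} [Fintype ι] [DecidableEq ι]

/-- The partial derivative `∂ᵢ φ` at `u`. -/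
def pderiv (b : Module.Basis ι ℝ E) (i : ι) (φ : E → ℝ) (u : E) : ℝ :=
  fderiv ℝ φ u (b i)

/-- The Christoffel symbol `Γᵏᵢⱼ` of the Levi-Civita connection. -/
def christoffel (b : Module.Basis ι ℝ E) (G : E → Matrix ι ι ℝ) (k i j : ι) (u : E) : ℝ :=
  (1 / 2) * ∑ l, (G u)⁻¹ k l *
    (pderiv b i (fun w => G w j l) u + pderiv b j (fun w => G w i l) u
      - pderiv b l (fun w => G w i j) u)

/-- The `s`-th component of `R(∂ᵢ, ∂ⱼ)∂ₖ`, where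
`R(X, Y)Z = ∇_X ∇_Y Z - ∇_Y ∇_X Z - ∇_[X, Y] Z`. -/
def riemUp (b : Module.Basis ι ℝ E) (G : E → Matrix ι ι ℝ) (s i j k : ι) (u : E) : ℝ :=
  pderiv b i (christoffel b G s j k) u - pderiv b j (christoffel b G s i k) u
    + ∑ t, (christoffel b G t j k u * christoffel b G s i t u
        - christoffel b G t i k u * christoffel b G s j t u)

/-- The Riemann-Christoffel curvature tensor `Rᵢⱼₖₗ = g(R(∂ᵢ, ∂ⱼ)∂ₖ, ∂ₗ)`; for the unit sphere
`Rᵢⱼₖₗ = gᵢₗ gⱼₖ - gᵢₖ gⱼₗ`. -/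
def riem (b : Module.Basis ι ℝ E) (G : E → Matrix ι ι ℝ) (i j k l : ι) (u : E) : ℝ :=
  ∑ s, G u l s * riemUp b G s i j k u

/-- The Ricci tensor `Sⱼₖ = gⁱˡ Rᵢⱼₖₗ`. -/
def ricci (b : Module.Basis ι ℝ E) (G : E → Matrix ι ι ℝ) (u : E) : Matrix ι ι ℝ :=
  Matrix.of fun j k => ∑ i, ∑ l, (G u)⁻¹ i l * riem b G i j k l u

/-- The scalar curvature `κ = gʲᵏ Sⱼₖ`. -/
def scal (b : Module.Basis ι ℝ E) (G : E → Matrix ι ι ℝ) (u : E) : ℝ :=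
  ∑ j, ∑ k, (G u)⁻¹ j k * ricci b G u j k

/-- The covariant derivative `Rᵢⱼₖₗ,ₘ = (∇_∂ₘ R)(∂ᵢ, ∂ⱼ, ∂ₖ, ∂ₗ)`. -/
def covRiem (b : Module.Basis ι ℝ E) (G : E → Matrix ι ι ℝ) (i j k l m : ι) (u : E) : ℝ :=
  pderiv b m (riem b G i j k l) u
    - ∑ s, (christoffel b G s m i u * riem b G s j k l u
      + christoffel b G s m j u * riem b G i s k l u
      + christoffel b G s m k u * riem b G i j s l u
      + christoffel b G s m l u * riem b G i j k s u)

/-- The Kulkarni-Nomizu product `A ∧ B` of two `(0,2)`-tensors at a point. -/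
def kn (A B : Matrix ι ι ℝ) (i j k l : ι) : ℝ :=
  A i l * B j k + A j k * B i l - A i k * B j l - A j l * B i k

/-- The conformal (Weyl) curvature tensor in dimension `card ι`; only meaningful if that is at
least three. -/
def weyl (b : Module.Basis ι ℝ E) (G : E → Matrix ι ι ℝ) (i j k l : ι) (u : E) : ℝ :=
  riem b G i j k l u - 1 / ((Fintype.card ι : ℝ) - 2) * kn (G u) (ricci b G u) i j k l
    + scal b G u / (2 * ((Fintype.card ι : ℝ) - 1) * ((Fintype.card ι : ℝ) - 2))
        * kn (G u) (G u) i j k l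

/-- The tensor `T_ab = (1/(2f)) (∇_b f_a - (1/(2f)) f_a f_b)` of a function `f`. -/
def warpT (b : Module.Basis ι ℝ E) (G : E → Matrix ι ι ℝ) (f : E → ℝ) (u : E) : Matrix ι ι ℝ :=
  Matrix.of fun i j => 1 / (2 * f u) *
    (pderiv b j (pderiv b i f) u - ∑ c, christoffel b G c j i u * pderiv b c f u
      - 1 / (2 * f u) * (pderiv b i f u * pderiv b j f u))

/-- `P = (1/(4f²)) gᵃᵇ f_a f_b`. -/
def warpP (b : Module.Basis ι ℝ E) (G : E → Matrix ι ι ℝ) (f : E → ℝ) (u : E) : ℝ :=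
  1 / (4 * f u ^ 2) * ∑ i, ∑ j, (G u)⁻¹ i j * (pderiv b i f u * pderiv b j f u)

/-- `Q = -f ((q - 1) P + tr T)`, where `q` is the dimension of the fiber and `tr T = gᵃᵇ T_ab`. -/
def warpQ (b : Module.Basis ι ℝ E) (G : E → Matrix ι ι ℝ) (f : E → ℝ) (q : ℕ) (u : E) : ℝ :=
  -(f u * (((q : ℝ) - 1) * warpP b G f u + ∑ i, ∑ j, (G u)⁻¹ i j * warpT b G f u i j))

end

end LocalGeom

/-! ### Semi-Riemannian manifolds -/

namespace SemiRiem

noncomputable section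

open LocalGeom

section Manifold

variable {E : Type*} [NormedAddCommGroup E] [NormedSpace ℝ E]
variable {H : Type*} [TopologicalSpace H] (I : ModelWithCorners ℝ E H)
variable (M : Type*) [TopologicalSpace M] [ChartedSpace H M]

/-- Fields of bilinear forms on the tangent spaces. -/
abbrev BilinField : Type _ :=
  ∀ x : M, LinearMap.BilinForm ℝ (TangentSpace I x)

/-- Fields of covectors. -/
abbrev CovectorField : Type _ :=
  ∀ x : M, TangentSpace I x →L[ℝ] ℝ

variable {I M}
variable {ι : Type*} [Fintype ι] [DecidableEq ι] (b : Module.Basis ι ℝ E)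

/-- The coordinate vector `∂ᵢ` of the chart around `x₀`, at the point with coordinates `u`. -/
def coordVec (x₀ : M) (i : ι) (u : E) : TangentSpace I ((extChartAt I x₀).symm u) :=
  mfderiv 𝓘(ℝ, E) I (extChartAt I x₀).symm u (b i)

/-- The components of a field of bilinear forms in the chart around `x₀`. -/
def comps (g : BilinField I M) (x₀ : M) (u : E) : Matrix ι ι ℝ :=
  Matrix.of fun i j =>
    g ((extChartAt I x₀).symm u) (coordVec (I := I) b x₀ i u) (coordVec (I := I) b x₀ j u)

/-- The components of a field of covectors in the chart around `x₀`. -/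
def comps₁ (P : CovectorField I M) (x₀ : M) (i : ι) (u : E) : ℝ :=
  P ((extChartAt I x₀).symm u) (coordVec (I := I) b x₀ i u)

/-- A semi-Riemannian metric: symmetric, nondegenerate, with smooth components in charts. -/
structure IsMetric (g : BilinField I M) : Prop where
  symm : ∀ x v w, g x v w = g x w v
  nondeg : ∀ x v, (∀ w, g x v w = 0) → v = 0
  smooth : ∀ (x₀ : M) (i j : ι),
    ContDiffOn ℝ ∞ (fun u => comps b g x₀ u i j) (extChartAt I x₀).target

/-- A smooth 1-form: a field of covectors with smooth components in charts. -/
def IsSmoothForm (P : CovectorField I M) : Prop :=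
  ∀ (x₀ : M) (i : ι), ContDiffOn ℝ ∞ (comps₁ b P x₀ i) (extChartAt I x₀).target

/-- At the point `x`, `∇R = ξ ⊗ R` for some covector `ξ`. -/
def RecurrentAt (g : BilinField I M) (x : M) : Prop :=
  ∃ ξ : ι → ℝ, ∀ i j k l m,
    covRiem b (comps b g x) i j k l m (extChartAt I x x)
      = ξ m * riem b (comps b g x) i j k l (extChartAt I x x)

/-- The identity `∇R = P ⊗ R + A ⊗ (S ∧ S) + B ⊗ (g ∧ S) + C ⊗ (g ∧ g)` at the point `x`. -/
def SGKAt (g : BilinField I M) (P A B C : CovectorField I M) (x : M) : Prop :=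
  ∀ i j k l m,
    covRiem b (comps b g x) i j k l m (extChartAt I x x)
      = comps₁ b P x m (extChartAt I x x) * riem b (comps b g x) i j k l (extChartAt I x x)
        + comps₁ b A x m (extChartAt I x x)
          * kn (ricci b (comps b g x) (extChartAt I x x))
              (ricci b (comps b g x) (extChartAt I x x)) i j k l
        + comps₁ b B x m (extChartAt I x x)
          * kn (comps b g x (extChartAt I x x))
              (ricci b (comps b g x) (extChartAt I x x)) i j k l
        + comps₁ b C x m (extChartAt I x x)
          * kn (comps b g x (extChartAt I x x)) (comps b g x (extChartAt I x x)) i j k l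

/-- The identity `∇R = P ⊗ R + B ⊗ (g ∧ S)` at the point `x`. -/
def HGKAt (g : BilinField I M) (P B : CovectorField I M) (x : M) : Prop :=
  ∀ i j k l m,
    covRiem b (comps b g x) i j k l m (extChartAt I x x)
      = comps₁ b P x m (extChartAt I x x) * riem b (comps b g x) i j k l (extChartAt I x x)
        + comps₁ b B x m (extChartAt I x x)
          * kn (comps b g x (extChartAt I x x))
              (ricci b (comps b g x) (extChartAt I x x)) i j k l

/-- Super generalized recurrent with associated 1-forms `(P, A, B, C)`: the identity holds
wherever `∇R` is not of the form `ξ ⊗ R`. -/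
def IsSGK (g : BilinField I M) (P A B C : CovectorField I M) : Prop :=
  (IsSmoothForm b P ∧ IsSmoothForm b A ∧ IsSmoothForm b B ∧ IsSmoothForm b C) ∧
    ∀ x, ¬ RecurrentAt b g x → SGKAt b g P A B C x

/-- Hyper generalized recurrent with associated 1-forms `(P, B)`: the identity holds
wherever `∇R` is not of the form `ξ ⊗ R`. -/
def IsHGK (g : BilinField I M) (P B : CovectorField I M) : Prop :=
  (IsSmoothForm b P ∧ IsSmoothForm b B) ∧ ∀ x, ¬ RecurrentAt b g x → HGKAt b g P B x

/-- The conformal curvature tensor vanishes at `x`. -/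
def WeylVanishesAt (g : BilinField I M) (x : M) : Prop :=
  ∀ i j k l, weyl b (comps b g x) i j k l (extChartAt I x x) = 0

/-- The Einstein metric condition `S = (κ / dim) g` at `x`. -/
def EinsteinAt (g : BilinField I M) (x : M) : Prop :=
  ricci b (comps b g x) (extChartAt I x x)
    = (scal b (comps b g x) (extChartAt I x x) / (Fintype.card ι : ℝ))
        • comps b g x (extChartAt I x x)

/-- Constant curvature: `R = (c/2) (g ∧ g)` with a real constant `c`. -/
def ConstantCurvature (g : BilinField I M) : Prop :=
  ∃ c : ℝ, ∀ x i j k l,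
    riem b (comps b g x) i j k l (extChartAt I x x)
      = c / 2 * kn (comps b g x (extChartAt I x x)) (comps b g x (extChartAt I x x)) i j k l

/-- Linear dependence of the tensor fields `T` (of the function `f`) and `S` (the Ricci tensor),
in all charts: `T = lam S` for a smooth function `lam`, or `S` vanishes identically. -/
def TDependsOnRicci (g : BilinField I M) (f : M → ℝ) : Prop :=
  (∃ lam : M → ℝ, ContMDiff I 𝓘(ℝ, ℝ) ∞ lam ∧
    ∀ x₀ : M, ∀ u ∈ (extChartAt I x₀).target,
      warpT b (comps b g x₀) (f ∘ (extChartAt I x₀).symm) u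
        = lam ((extChartAt I x₀).symm u) • ricci b (comps b g x₀) u) ∨
  ∀ x₀ : M, ∀ u ∈ (extChartAt I x₀).target, ricci b (comps b g x₀) u = 0

/-- The function `P` of `f` on the manifold. -/
def fieldP (g : BilinField I M) (f : M → ℝ) (x : M) : ℝ :=
  warpP b (comps b g x) (f ∘ (extChartAt I x).symm) (extChartAt I x x)

/-- The function `Q` of `f` on the manifold, for a fiber of dimension `q`. -/
def fieldQ (g : BilinField I M) (f : M → ℝ) (q : ℕ) (x : M) : ℝ :=
  warpQ b (comps b g x) (f ∘ (extChartAt I x).symm) q (extChartAt I x x)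

/-- The differential `df`. -/
def differential (I : ModelWithCorners ℝ E H) (f : M → ℝ) : CovectorField I M :=
  fun x => (mfderiv I 𝓘(ℝ, ℝ) f x : TangentSpace I x →L[ℝ] ℝ)

end Manifold

section Product

variable {E F : Type*} [NormedAddCommGroup E] [NormedSpace ℝ E]
  [NormedAddCommGroup F] [NormedSpace ℝ F]
variable {H K : Type*} [TopologicalSpace H] [TopologicalSpace K]
variable {I : ModelWithCorners ℝ E H} {J : ModelWithCorners ℝ F K}
variable {M N : Type*} [TopologicalSpace M] [ChartedSpace H M]
  [TopologicalSpace N] [ChartedSpace K N]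

/-- The warped product metric `π^* gB + (f ∘ π) σ^* gF` on `M × N`, with the projections `π`, `σ`
onto the base `M` and the fiber `N`. -/
def warped (gB : BilinField I M) (gF : BilinField J N) (f : M → ℝ) :
    BilinField (I.prod J) (M × N) := fun z =>
  (gB z.1).compl₁₂ (mfderiv (I.prod J) I Prod.fst z).toLinearMap
      (mfderiv (I.prod J) I Prod.fst z).toLinearMap
    + f z.1 • (gF z.2).compl₁₂ (mfderiv (I.prod J) J Prod.snd z).toLinearMap
      (mfderiv (I.prod J) J Prod.snd z).toLinearMap

/-- The restriction of a 1-form on `M × N` to the copy `M × {y}` of the base. -/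
def basePart (P : CovectorField (I.prod J) (M × N)) (y : N) : CovectorField I M :=
  fun x => (P (x, y)).comp (mfderiv I (I.prod J) (fun x' : M => (x', y)) x)

/-- The restriction of a 1-form on `M × N` to the copy `{x} × N` of the fiber. -/
def fiberPart (P : CovectorField (I.prod J) (M × N)) (x : M) : CovectorField J N :=
  fun y => (P (x, y)).comp (mfderiv J (I.prod J) (fun y' : N => (x, y')) y)

end Product

/-- The standard basis of `ℝ^d`. -/
abbrev stdBasis (d : ℕ) : Module.Basis (Fin d) ℝ (EuclideanSpace ℝ (Fin d)) :=
  (EuclideanSpace.basisFun (Fin d) ℝ).toBasis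

/-- The standard basis of `ℝ^p × ℝ^q`. -/
abbrev prodBasis (p q : ℕ) : Module.Basis (Fin p ⊕ Fin q) ℝ
    (EuclideanSpace ℝ (Fin p) × EuclideanSpace ℝ (Fin q)) :=
  (stdBasis p).prod (stdBasis q)

end

end SemiRiem

open SemiRiem

/-! Every claim is pointwise, so the argument takes place at the centre of a product chart, where
$g$ is the block matrix with blocks $\overline g$ and $f\widetilde g$. From its Christoffel symbols
one obtains the blocks of $R$, $S$ and of the needed components of $\nabla R$; each claim is then
(H) read in one block (`WarpData.base_identity` to `WarpData.riem_eq_const_mul_kn`). Write $q=n-p$.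

All indices in the base: $\overline\nabla\,\overline R=\overline\Pi\otimes\overline
R+\overline\Psi\otimes\overline g\wedge(\overline S-qT)$. If $T=\lambda\overline S$, the last factor
is $(1-q\lambda)\overline S$. If $\overline S\equiv0$, contraction removes the last term
(`SmoothMetricOn.recurrent_of_ricci_eq_zero`).

All indices in the fiber: since $\widetilde g\wedge\widetilde g$ is parallel, (H) becomes (G) for
$\widetilde M$, with the stated $\Theta$ coming from $P$ and $Q$.

$R$ in the fiber, derivative along the base: $(f_a+f\Pi_a)\widetilde R$ has the form $\widetilde
g\wedge A$, which forces the conformal tensor to vanish when the factor is nonzero.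

$R_{a\beta b\delta}$, any derivative: every term except $\Psi_m\overline g_{ab}\widetilde
S_{\beta\delta}$ is a multiple of $\widetilde g_{\beta\delta}$, so $\Psi_m\neq0$ gives the Einstein
condition.

$\nabla_\varepsilon R_{a\beta\gamma\delta}$: here $R$ and $g\wedge S$ both vanish, while the
Christoffel terms of $\nabla R$ contain $f_a\widetilde R$. Hence $f_a\neq0$ gives $\widetilde
R=\frac c2\widetilde g\wedge\widetilde g$ with $c$ depending on the base point only.

(H) is assumed only on $U_M$. Elsewhere $\nabla R=\xi\otimes R$, which is (H) with another pair of
covectors, the second being zero. This suffices for constant curvature. For (i) and (ii) one also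
needs that recurrence of $R$ at $(x,y)$ passes to the base at $x$ and to the fiber at $y$; the
latter is `WarpData.exists_recurrent_fiber`. -/

namespace LocalGeom

/-! ### Partial derivatives, and a metric in coordinates. -/

section Calculus

variable {E : Type*} [NormedAddCommGroup E] [NormedSpace ℝ E]
variable {ι : Type*} (b : Module.Basis ι ℝ E)

theorem pderiv_congr {φ ψ : E → ℝ} {u : E} (h : φ =ᶠ[nhds u] ψ) (i : ι) :
    pderiv b i φ u = pderiv b i ψ u := by
  simp only [pderiv, h.fderiv_eq]

theorem pderiv_const (c : ℝ) (i : ι) (u : E) : pderiv b i (fun _ => c) u = 0 := by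
  simp [pderiv]

theorem pderiv_add {φ ψ : E → ℝ} {u : E} (hφ : DifferentiableAt ℝ φ u)
    (hψ : DifferentiableAt ℝ ψ u) (i : ι) :
    pderiv b i (fun w => φ w + ψ w) u = pderiv b i φ u + pderiv b i ψ u := by
  simp [pderiv, fderiv_fun_add hφ hψ]

theorem pderiv_sub {φ ψ : E → ℝ} {u : E} (hφ : DifferentiableAt ℝ φ u)
    (hψ : DifferentiableAt ℝ ψ u) (i : ι) :
    pderiv b i (fun w => φ w - ψ w) u = pderiv b i φ u - pderiv b i ψ u := by
  simp [pderiv, fderiv_fun_sub hφ hψ]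

theorem pderiv_mul {φ ψ : E → ℝ} {u : E} (hφ : DifferentiableAt ℝ φ u)
    (hψ : DifferentiableAt ℝ ψ u) (i : ι) :
    pderiv b i (fun w => φ w * ψ w) u = pderiv b i φ u * ψ u + φ u * pderiv b i ψ u := by
  simp [pderiv, fderiv_fun_mul hφ hψ]
  ring

theorem pderiv_const_mul {ψ : E → ℝ} {u : E} (c : ℝ) (hψ : DifferentiableAt ℝ ψ u) (i : ι) :
    pderiv b i (fun w => c * ψ w) u = c * pderiv b i ψ u := by
  simp [pderiv, fderiv_const_mul hψ]

theorem pderiv_div {φ ψ : E → ℝ} {u : E} (hφ : DifferentiableAt ℝ φ u)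
    (hψ : DifferentiableAt ℝ ψ u) (h : ψ u ≠ 0) (i : ι) :
    pderiv b i (fun w => φ w / ψ w) u
      = (pderiv b i φ u * ψ u - φ u * pderiv b i ψ u) / ψ u ^ 2 := by
  have hq : DifferentiableAt ℝ (fun w => φ w / ψ w) u := by
    simp only [div_eq_mul_inv]
    exact hφ.mul (hψ.inv h)
  have h1 := pderiv_mul b hq hψ i
  -- The quotient rule is read off from the product rule for $(\varphi/\psi)\psi=\varphi$, valid
  -- near $u$.
  have h2 : (fun w => φ w / ψ w * ψ w) =ᶠ[nhds u] φ := by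
    filter_upwards [hψ.continuousAt.eventually_ne h] with w hw
    field_simp
  rw [pderiv_congr b h2] at h1
  field_simp
  field_simp at h1
  linarith

theorem pderiv_sum {α : Type*} (s : Finset α) {φ : α → E → ℝ} {u : E}
    (hφ : ∀ a ∈ s, DifferentiableAt ℝ (φ a) u) (i : ι) :
    pderiv b i (fun w => ∑ a ∈ s, φ a w) u = ∑ a ∈ s, pderiv b i (φ a) u := by
  simp [pderiv, fderiv_fun_sum hφ]

theorem contDiffOn_pderiv {φ : E → ℝ} {U : Set E} (hU : IsOpen U) (hφ : ContDiffOn ℝ ∞ φ U)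
    (i : ι) : ContDiffOn ℝ ∞ (pderiv b i φ) U :=
  (hφ.fderiv_of_isOpen hU (by simp)).clm_apply contDiffOn_const

theorem pderiv_comm {φ : E → ℝ} {U : Set E} (hU : IsOpen U) (hφ : ContDiffOn ℝ ∞ φ U)
    {u : E} (hu : u ∈ U) (i j : ι) :
    pderiv b i (pderiv b j φ) u = pderiv b j (pderiv b i φ) u := by
  have hat : ContDiffAt ℝ ∞ φ u := hφ.contDiffAt (hU.mem_nhds hu)
  have hd : DifferentiableAt ℝ (fderiv ℝ φ) u :=
    ((hφ.fderiv_of_isOpen (m := ∞) hU (by simp)).contDiffAt (hU.mem_nhds hu)).differentiableAt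
      (by simp)
  have key : ∀ k l, pderiv b k (pderiv b l φ) u = fderiv ℝ (fderiv ℝ φ) u (b k) (b l) := by
    intro k l
    unfold pderiv
    rw [fderiv_clm_apply hd (differentiableAt_const _)]
    simp
  rw [key, key]
  exact (hat.isSymmSndFDerivAt (by simp; exact WithTop.coe_le_coe.2 (le_top : (2 : ℕ∞) ≤ ⊤))) _ _

theorem differentiableAt_of_contDiffOn {φ : E → ℝ} {U : Set E} (hU : IsOpen U)
    (hφ : ContDiffOn ℝ ∞ φ U) {u : E} (hu : u ∈ U) : DifferentiableAt ℝ φ u :=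
  (hφ.contDiffAt (hU.mem_nhds hu)).differentiableAt (by simp)

/-- The entrywise partial derivative of a matrix-valued function. -/
noncomputable def pderivMat {κ ν : Type*} (i : ι) (A : E → Matrix κ ν ℝ) (u : E) : Matrix κ ν ℝ :=
  Matrix.of fun k l => pderiv b i (fun w => A w k l) u

theorem pderivMat_mul {κ ν τ : Type*} [Fintype ν] {A : E → Matrix κ ν ℝ}
    {C : E → Matrix ν τ ℝ} {u : E}
    (hA : ∀ k l, DifferentiableAt ℝ (fun w => A w k l) u)
    (hC : ∀ k l, DifferentiableAt ℝ (fun w => C w k l) u) (i : ι) :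
    pderivMat b i (fun w => A w * C w) u = pderivMat b i A u * C u + A u * pderivMat b i C u := by
  ext k l
  simp only [pderivMat, Matrix.mul_apply, Matrix.of_apply, Matrix.add_apply]
  rw [pderiv_sum b _ (φ := fun a w => A w k a * C w a l) (fun a _ => (hA k a).mul (hC a l)),
    ← Finset.sum_add_distrib]
  exact Finset.sum_congr rfl fun a _ => pderiv_mul b (hA k a) (hC a l) i

theorem pderivMat_add {κ ν : Type*} {A C : E → Matrix κ ν ℝ} {u : E}
    (hA : ∀ k l, DifferentiableAt ℝ (fun w => A w k l) u)
    (hC : ∀ k l, DifferentiableAt ℝ (fun w => C w k l) u) (i : ι) :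
    pderivMat b i (fun w => A w + C w) u = pderivMat b i A u + pderivMat b i C u := by
  ext k l
  exact pderiv_add b (hA k l) (hC k l) i

theorem contDiffOn_det {κ : Type*} [Fintype κ] [DecidableEq κ] {A : E → Matrix κ κ ℝ} {U : Set E}
    (hA : ∀ k l, ContDiffOn ℝ ∞ (fun w => A w k l) U) :
    ContDiffOn ℝ ∞ (fun w => (A w).det) U := by
  simp only [Matrix.det_apply']
  exact ContDiffOn.sum fun σ _ => contDiffOn_const.mul (contDiffOn_prod fun k _ => hA _ _)

theorem contDiffOn_adjugate {κ : Type*} [Fintype κ] [DecidableEq κ] {A : E → Matrix κ κ ℝ}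
    {U : Set E} (hA : ∀ k l, ContDiffOn ℝ ∞ (fun w => A w k l) U) (k l : κ) :
    ContDiffOn ℝ ∞ (fun w => (A w).adjugate k l) U := by
  simp only [Matrix.adjugate_apply]
  refine contDiffOn_det fun r s => ?_
  by_cases h : r = l
  · subst h
    simpa using contDiffOn_const
  · simpa [Matrix.updateRow_ne h] using hA r s

variable [Fintype ι] [DecidableEq ι]

/-- A smooth semi-Riemannian metric in coordinates on an open set. -/
structure SmoothMetricOn (G : E → Matrix ι ι ℝ) (U : Set E) : Prop where
  isOpen : IsOpen U
  symm : ∀ u ∈ U, (G u).transpose = G u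
  det : ∀ u ∈ U, IsUnit (G u).det
  smooth : ∀ i j, ContDiffOn ℝ ∞ (fun u => G u i j) U

namespace SmoothMetricOn

variable {G : E → Matrix ι ι ℝ} {U : Set E} {u : E}

theorem smooth_inv (h : SmoothMetricOn G U) (i j : ι) :
    ContDiffOn ℝ ∞ (fun u => (G u)⁻¹ i j) U := by
  have h1 : ContDiffOn ℝ ∞ (fun u => ((G u).det)⁻¹ * (G u).adjugate i j) U :=
    ((contDiffOn_det h.smooth).inv fun u hu => (h.det u hu).ne_zero).mul
      (contDiffOn_adjugate h.smooth i j)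
  exact h1.congr fun u _ => by simp [Matrix.inv_def]

theorem smooth_christoffel (h : SmoothMetricOn G U) (k i j : ι) :
    ContDiffOn ℝ ∞ (christoffel b G k i j) U := by
  unfold christoffel
  exact contDiffOn_const.mul (ContDiffOn.sum fun l _ => (h.smooth_inv k l).mul
    (((contDiffOn_pderiv b h.isOpen (h.smooth _ _) i).add
      (contDiffOn_pderiv b h.isOpen (h.smooth _ _) j)).sub
      (contDiffOn_pderiv b h.isOpen (h.smooth _ _) l)))

theorem smooth_riemUp (h : SmoothMetricOn G U) (s i j k : ι) :
    ContDiffOn ℝ ∞ (riemUp b G s i j k) U := by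
  unfold riemUp
  have hc := h.smooth_christoffel b
  exact ((contDiffOn_pderiv b h.isOpen (hc _ _ _) i).sub
    (contDiffOn_pderiv b h.isOpen (hc _ _ _) j)).add
      (ContDiffOn.sum fun t _ => ((hc _ _ _).mul (hc _ _ _)).sub ((hc _ _ _).mul (hc _ _ _)))

theorem smooth_riem (h : SmoothMetricOn G U) (i j k l : ι) :
    ContDiffOn ℝ ∞ (riem b G i j k l) U := by
  unfold riem
  exact ContDiffOn.sum fun s _ => (h.smooth _ _).mul (h.smooth_riemUp b s i j k)

theorem diff (h : SmoothMetricOn G U) {φ : E → ℝ} (hφ : ContDiffOn ℝ ∞ φ U) (hu : u ∈ U) :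
    DifferentiableAt ℝ φ u := differentiableAt_of_contDiffOn h.isOpen hφ hu

theorem mul_inv (h : SmoothMetricOn G U) (hu : u ∈ U) : G u * (G u)⁻¹ = 1 :=
  Matrix.mul_nonsing_inv _ (h.det u hu)

theorem inv_mul (h : SmoothMetricOn G U) (hu : u ∈ U) : (G u)⁻¹ * G u = 1 :=
  Matrix.nonsing_inv_mul _ (h.det u hu)

theorem symm_apply (h : SmoothMetricOn G U) (hu : u ∈ U) (i j : ι) : G u i j = G u j i := by
  conv_lhs => rw [← h.symm u hu]
  rfl

theorem pderiv_symm (h : SmoothMetricOn G U) (hu : u ∈ U) (i k l : ι) :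
    pderiv b i (fun w => G w k l) u = pderiv b i (fun w => G w l k) u :=
  pderiv_congr b (by
    filter_upwards [h.isOpen.mem_nhds hu] with w hw using h.symm_apply hw k l) i

theorem christoffel_symm (h : SmoothMetricOn G U) (hu : u ∈ U) (k i j : ι) :
    christoffel b G k i j u = christoffel b G k j i u := by
  unfold christoffel
  congr 1
  refine Finset.sum_congr rfl fun l _ => ?_
  rw [h.pderiv_symm b hu l i j]
  ring

theorem lower_christoffel (h : SmoothMetricOn G U) (hu : u ∈ U) (l i j : ι) :
    ∑ s, G u l s * christoffel b G s i j u = (1 / 2) *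
      (pderiv b i (fun w => G w j l) u + pderiv b j (fun w => G w i l) u
        - pderiv b l (fun w => G w i j) u) := by
  have h1 := h.mul_inv hu
  set c : ι → ℝ := fun l => pderiv b i (fun w => G w j l) u + pderiv b j (fun w => G w i l) u
        - pderiv b l (fun w => G w i j) u with hc
  have h2 : ∀ s, christoffel b G s i j u = (1 / 2) * ((G u)⁻¹.mulVec c) s := fun s => rfl
  calc ∑ s, G u l s * christoffel b G s i j u
      = (1 / 2) * ((G u).mulVec ((G u)⁻¹.mulVec c)) l := by
        simp only [h2, Matrix.mulVec, dotProduct, Finset.mul_sum]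
        refine Finset.sum_congr rfl fun s _ => Finset.sum_congr rfl fun t _ => by ring
    _ = (1 / 2) * c l := by rw [Matrix.mulVec_mulVec, h1, Matrix.one_mulVec]

end SmoothMetricOn

/-- The matrix `(Γᵢ)ˢₖ = Γˢᵢₖ`. -/
noncomputable def christoffelMat (G : E → Matrix ι ι ℝ) (i : ι) (u : E) : Matrix ι ι ℝ :=
  Matrix.of fun s k => christoffel b G s i k u

namespace SmoothMetricOn

variable {G : E → Matrix ι ι ℝ} {U : Set E} {u : E}

/-- This is $\nabla g=0$ in matrix form: in the sum of the two lowered Christoffel symbols all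
derivatives of $g$ cancel except the $i$-th ones. -/
theorem pderivMat_metric (h : SmoothMetricOn G U) (hu : u ∈ U) (i : ι) :
    pderivMat b i G u = (christoffelMat b G i u).transpose * G u + G u * christoffelMat b G i u := by
  ext k l
  have h1 := h.lower_christoffel b hu k i l
  have h2 := h.lower_christoffel b hu l i k
  simp only [pderivMat, Matrix.of_apply, Matrix.add_apply, Matrix.mul_apply, Matrix.transpose_apply,
    christoffelMat]
  have h3 : ∑ s, christoffel b G s i k u * G u s l = ∑ s, G u l s * christoffel b G s i k u :=
    Finset.sum_congr rfl fun s _ => by rw [h.symm_apply hu s l]; ring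
  rw [h3, h1, h2, h.pderiv_symm b hu i l k, h.pderiv_symm b hu k i l, h.pderiv_symm b hu l i k,
    h.pderiv_symm b hu k l i]
  ring

theorem pderivMat_inv (h : SmoothMetricOn G U) (hu : u ∈ U) (i : ι) :
    pderivMat b i (fun w => (G w)⁻¹) u
      = -((G u)⁻¹ * (christoffelMat b G i u).transpose + christoffelMat b G i u * (G u)⁻¹) := by
  have h1 := pderivMat_mul b (A := fun w => (G w)⁻¹) (C := G) (u := u)
    (fun k l => h.diff (h.smooth_inv k l) hu) (fun k l => h.diff (h.smooth k l) hu) i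
  have h2 : pderivMat b i (fun w => (G w)⁻¹ * G w) u = 0 := by
    ext k l
    have : (fun w => ((G w)⁻¹ * G w) k l) =ᶠ[nhds u] fun _ => (1 : Matrix ι ι ℝ) k l := by
      filter_upwards [h.isOpen.mem_nhds hu] with w hw
      rw [h.inv_mul hw]
    simp only [pderivMat, Matrix.of_apply]
    rw [pderiv_congr b this, pderiv_const]
    rfl
  rw [h2, h.pderivMat_metric b hu] at h1
  have h3 := congrArg (· * (G u)⁻¹) h1
  simp only [Matrix.zero_mul, Matrix.add_mul, Matrix.mul_assoc, h.mul_inv hu, Matrix.mul_one,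
    Matrix.mul_add] at h3
  rw [← Matrix.mul_assoc (G u)⁻¹ (G u), h.inv_mul hu, Matrix.one_mul] at h3
  exact eq_neg_of_add_eq_zero_left h3.symm

/-- Second derivatives of $G$ commute. Inserting $\partial G=\Gamma^{\mathsf T}G+G\Gamma$ twice
turns this into $W^{\mathsf T}G+GW=0$ for the curvature matrix
$W=\partial_i\Gamma_j-\partial_j\Gamma_i+[\Gamma_i,\Gamma_j]$, and $GW$ is $R_{ijkl}$ with rows $l$
and columns $k$. -/
theorem riem_skew (h : SmoothMetricOn G U) (hu : u ∈ U) (i j k l : ι) :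
    riem b G i j k l u = -riem b G i j l k u := by
  have dG : ∀ k l, DifferentiableAt ℝ (fun w => G w k l) u := fun k l => h.diff (h.smooth k l) hu
  have dC : ∀ i k l, DifferentiableAt ℝ (fun w => christoffelMat b G i w k l) u :=
    fun i k l => h.diff (h.smooth_christoffel b _ _ _) hu
  have second : ∀ i j, pderivMat b i (pderivMat b j G) u
      = (pderivMat b i (christoffelMat b G j) u).transpose * G u
        + (christoffelMat b G j u).transpose * pderivMat b i G u
        + (pderivMat b i G u * christoffelMat b G j u
          + G u * pderivMat b i (christoffelMat b G j) u) := by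
    intro i j
    have e : pderivMat b i (pderivMat b j G) u = pderivMat b i (fun w =>
        (christoffelMat b G j w).transpose * G w + G w * christoffelMat b G j w) u := by
      ext k l
      refine pderiv_congr b ?_ i
      filter_upwards [h.isOpen.mem_nhds hu] with w hw
      rw [h.pderivMat_metric b hw]
    have d1 : ∀ k l, DifferentiableAt ℝ
        (fun w => ((christoffelMat b G j w).transpose * G w) k l) u := by
      intro k l
      simp only [Matrix.mul_apply]
      exact DifferentiableAt.fun_sum fun s _ => (dC _ _ _).mul (dG _ _)
    have d2 : ∀ k l, DifferentiableAt ℝ (fun w => (G w * christoffelMat b G j w) k l) u := by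
      intro k l
      simp only [Matrix.mul_apply]
      exact DifferentiableAt.fun_sum fun s _ => (dG _ _).mul (dC _ _ _)
    rw [e, pderivMat_add b d1 d2, pderivMat_mul b (A := fun w => (christoffelMat b G j w).transpose) (fun k l => dC j l k) dG,
      pderivMat_mul b dG (dC j)]
    rfl
  have comm : pderivMat b i (pderivMat b j G) u = pderivMat b j (pderivMat b i G) u := by
    ext k l
    exact pderiv_comm b h.isOpen (h.smooth k l) hu i j
  rw [second, second, h.pderivMat_metric b hu, h.pderivMat_metric b hu] at comm
  set A := christoffelMat b G i u
  set C := christoffelMat b G j u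
  set W := pderivMat b i (christoffelMat b G j) u - pderivMat b j (christoffelMat b G i) u
    + (A * C - C * A) with hW
  have hskew : W.transpose * G u + G u * W = 0 := by
    rw [← sub_eq_zero] at comm
    rw [← comm, hW]
    simp only [Matrix.transpose_add, Matrix.transpose_sub, Matrix.transpose_mul]
    noncomm_ring
  have hr : ∀ k l, riem b G i j k l u = (G u * W) l k := by
    intro k l
    simp only [riem, Matrix.mul_apply]
    refine Finset.sum_congr rfl fun s _ => ?_
    congr 1
    simp only [hW, Matrix.add_apply, Matrix.sub_apply, Matrix.mul_apply, riemUp,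
      Finset.sum_sub_distrib]
    congr 2 <;> exact Finset.sum_congr rfl fun t _ => mul_comm _ _
  have hs := congrFun (congrFun hskew l) k
  have ht : (W.transpose * G u) l k = (G u * W) k l := by
    rw [← Matrix.transpose_apply (G u * W), Matrix.transpose_mul, h.symm u hu]
  rw [Matrix.add_apply, ht] at hs
  rw [hr, hr]
  exact eq_neg_of_add_eq_zero_right hs

end SmoothMetricOn

theorem riem_antisymm (G : E → Matrix ι ι ℝ) (i j k l : ι) (u : E) :
    riem b G i j k l u = -riem b G j i k l u := by
  simp only [riem, riemUp, Finset.sum_sub_distrib, ← Finset.sum_neg_distrib]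
  exact Finset.sum_congr rfl fun s _ => by ring

section Congr

variable {G G' : E → Matrix ι ι ℝ} {u : E}

/-- Germs are compared rather than values, because the next tensor differentiates this one. This is
needed since the product metric is identified with a block matrix only on the chart domain. -/
theorem christoffel_eventuallyEq (h : G =ᶠ[nhds u] G') (k i j : ι) :
    christoffel b G k i j =ᶠ[nhds u] christoffel b G' k i j := by
  have hp : ∀ᶠ w in nhds u, ∀ i k l, pderiv b i (fun w => G w k l) w
      = pderiv b i (fun w => G' w k l) w := by
    filter_upwards [h.eventuallyEq_nhds] with w hw i k l
    exact pderiv_congr b (hw.mono fun v hv => by rw [hv]) i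
  filter_upwards [h, hp] with w hw hpw
  simp only [christoffel, hw, hpw]

theorem riem_eventuallyEq (h : G =ᶠ[nhds u] G') (i j k l : ι) :
    riem b G i j k l =ᶠ[nhds u] riem b G' i j k l := by
  have hc : ∀ᶠ w in nhds u, ∀ i j k, christoffel b G i j k =ᶠ[nhds w] christoffel b G' i j k := by
    filter_upwards [h.eventuallyEq_nhds] with w hw i j k
    exact christoffel_eventuallyEq b hw i j k
  filter_upwards [h, hc] with w hw hcw
  simp only [riem, riemUp, hw, pderiv_congr b (hcw _ _ _), (hcw _ _ _).eq_of_nhds]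

theorem covRiem_congr (h : G =ᶠ[nhds u] G') (i j k l m : ι) :
    covRiem b G i j k l m u = covRiem b G' i j k l m u := by
  simp only [covRiem, pderiv_congr b (riem_eventuallyEq b h _ _ _ _),
    (riem_eventuallyEq b h _ _ _ _).eq_of_nhds, (christoffel_eventuallyEq b h _ _ _).eq_of_nhds]

theorem ricci_congr (h : G =ᶠ[nhds u] G') : ricci b G u = ricci b G' u := by
  simp only [ricci, (riem_eventuallyEq b h _ _ _ _).eq_of_nhds, h.eq_of_nhds]

end Congr

end Calculus

end LocalGeom

/-! ### Contractions with the inverse metric. -/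

namespace LocalGeom

section Contraction

variable {ι : Type*} [Fintype ι] [DecidableEq ι]

theorem sum_inv_mul_self {g : Matrix ι ι ℝ} (hs : g.transpose = g) (hd : IsUnit g.det) :
    ∑ i, ∑ l, g⁻¹ i l * g i l = Fintype.card ι := by
  have h : (g⁻¹ * g).trace = Fintype.card ι := by
    rw [Matrix.nonsing_inv_mul _ hd, Matrix.trace_one]
  rw [← h, Matrix.trace]
  refine Finset.sum_congr rfl fun i _ => ?_
  simp only [Matrix.diag_apply, Matrix.mul_apply]
  refine Finset.sum_congr rfl fun l _ => ?_
  conv_lhs => rw [← hs, Matrix.transpose_apply, hs]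

/-- The contraction `gⁱˡ (g ∧ A)ᵢⱼₖₗ = (n - 2) Aⱼₖ + (tr A) gⱼₖ`. -/
theorem contract_kn {g : Matrix ι ι ℝ} (hs : g.transpose = g) (hd : IsUnit g.det)
    (A : Matrix ι ι ℝ) (j k : ι) :
    ∑ i, ∑ l, g⁻¹ i l * kn g A i j k l
      = ((Fintype.card ι : ℝ) - 2) * A j k + (∑ i, ∑ l, g⁻¹ i l * A i l) * g j k := by
  have hsi : g⁻¹.transpose = g⁻¹ := by rw [Matrix.transpose_nonsing_inv, hs]
  have ap : ∀ i l, g i l = g l i := fun i l => by conv_lhs => rw [← hs, Matrix.transpose_apply]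
  have api : ∀ i l, g⁻¹ i l = g⁻¹ l i :=
    fun i l => by conv_lhs => rw [← hsi, Matrix.transpose_apply]
  have h1 : ∀ l m, ∑ i, g⁻¹ l i * g i m = (1 : Matrix ι ι ℝ) l m := fun l m => by
    rw [← Matrix.nonsing_inv_mul _ hd, Matrix.mul_apply]
  have e1 : ∑ i, ∑ l, g⁻¹ i l * (g i k * A j l) = A j k := by
    rw [Finset.sum_comm]
    calc _ = ∑ l, (∑ i, g⁻¹ l i * g i k) * A j l := by
          refine Finset.sum_congr rfl fun l _ => ?_
          rw [Finset.sum_mul]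
          exact Finset.sum_congr rfl fun i _ => by rw [api]; ring
      _ = A j k := by simp [h1, Matrix.one_apply]
  have e2 : ∑ i, ∑ l, g⁻¹ i l * (g j l * A i k) = A j k := by
    calc _ = ∑ i, (∑ l, g⁻¹ i l * g l j) * A i k := by
          refine Finset.sum_congr rfl fun l _ => ?_
          rw [Finset.sum_mul]
          exact Finset.sum_congr rfl fun i _ => by rw [ap]; ring
      _ = A j k := by simp [h1, Matrix.one_apply]
  calc _ = (∑ i, ∑ l, g⁻¹ i l * g i l) * A j k + (∑ i, ∑ l, g⁻¹ i l * A i l) * g j k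
        - ∑ i, ∑ l, g⁻¹ i l * (g i k * A j l) - ∑ i, ∑ l, g⁻¹ i l * (g j l * A i k) := by
        simp only [Finset.sum_mul, ← Finset.sum_add_distrib, ← Finset.sum_sub_distrib]
        refine Finset.sum_congr rfl fun i _ => Finset.sum_congr rfl fun l _ => ?_
        simp only [kn]
        ring
    _ = _ := by
        rw [e1, e2, sum_inv_mul_self hs hd]
        ring

end Contraction

section Trace

variable {E : Type*} [NormedAddCommGroup E] [NormedSpace ℝ E]
variable {ι : Type*} [Fintype ι] [DecidableEq ι] (b : Module.Basis ι ℝ E)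
variable {G : E → Matrix ι ι ℝ} {U : Set E} {u : E}

/-- Covariant differentiation commutes with the contraction that defines the Ricci tensor. -/
theorem SmoothMetricOn.contract_covRiem (h : SmoothMetricOn G U) (hu : u ∈ U) (j k m : ι) :
    ∑ i, ∑ l, (G u)⁻¹ i l * covRiem b G i j k l m u
      = pderiv b m (fun w => ricci b G w j k) u
        - ∑ s, (christoffel b G s m j u * ricci b G u s k
          + christoffel b G s m k u * ricci b G u j s) := by
  -- The index $l$ labels rows, so that the Ricci component is the trace of $G^{-1}W$.
  set W : E → Matrix ι ι ℝ := fun w => Matrix.of fun l i => riem b G i j k l w with hW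
  set C := christoffelMat b G m u with hC
  have tr : ∀ A D : Matrix ι ι ℝ, (A * D).trace = ∑ i, ∑ l, A i l * D l i := fun A D => rfl
  have hric : (fun w => ricci b G w j k)
      = fun w => ∑ i, ((G w)⁻¹ * W w) i i := by
    funext w
    rfl
  have dI : ∀ k l, DifferentiableAt ℝ (fun w => (G w)⁻¹ k l) u :=
    fun k l => h.diff (h.smooth_inv k l) hu
  have dW : ∀ l i, DifferentiableAt ℝ (fun w => W w l i) u :=
    fun l i => h.diff (h.smooth_riem b i j k l) hu
  have d1 : ∀ i, DifferentiableAt ℝ (fun w => ((G w)⁻¹ * W w) i i) u := by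
    intro i
    simp only [Matrix.mul_apply]
    exact DifferentiableAt.fun_sum fun s _ => (dI _ _).mul (dW _ _)
  have hd : pderiv b m (fun w => ricci b G w j k) u
      = (-((G u)⁻¹ * C.transpose + C * (G u)⁻¹) * W u + (G u)⁻¹ * pderivMat b m W u).trace := by
    rw [hric, pderiv_sum b _ (fun i _ => d1 i), ← h.pderivMat_inv b hu, ← pderivMat_mul b dI dW]
    rfl
  have hcov : ∑ i, ∑ l, (G u)⁻¹ i l * covRiem b G i j k l m u
      = ((G u)⁻¹ * (pderivMat b m W u - W u * C - C.transpose * W u)).trace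
        - ∑ s, (christoffel b G s m j u * ricci b G u s k
          + christoffel b G s m k u * ricci b G u j s) := by
    have e : ∑ s, (christoffel b G s m j u * ricci b G u s k
        + christoffel b G s m k u * ricci b G u j s)
        = ∑ i, ∑ l, (G u)⁻¹ i l * ∑ s, (christoffel b G s m j u * riem b G i s k l u
          + christoffel b G s m k u * riem b G i j s l u) := by
      simp only [ricci, Matrix.of_apply, Finset.mul_sum, ← Finset.sum_add_distrib]
      rw [Finset.sum_comm]
      refine Finset.sum_congr rfl fun i _ => ?_
      rw [Finset.sum_comm]
      exact Finset.sum_congr rfl fun l _ => Finset.sum_congr rfl fun s _ => by ring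
    rw [e, tr, ← Finset.sum_sub_distrib]
    refine Finset.sum_congr rfl fun i _ => ?_
    rw [← Finset.sum_sub_distrib]
    refine Finset.sum_congr rfl fun l _ => ?_
    rw [← mul_sub]
    congr 1
    simp only [covRiem, Matrix.sub_apply, Matrix.mul_apply, Matrix.transpose_apply, hC, hW,
      christoffelMat, pderivMat, Matrix.of_apply, Finset.sum_add_distrib]
    simp only [mul_comm (riem b G _ j k l u)]
    ring
  rw [hcov, hd]
  congr 1
  simp only [Matrix.trace_add, Matrix.mul_sub, Matrix.trace_sub, neg_add, Matrix.add_mul,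
    Matrix.neg_mul, Matrix.trace_neg]
  -- By cyclicity of the trace, the Christoffel terms from $\partial_mG^{-1}$ match those of $\nabla
  -- R$ in the two contracted slots.
  rw [Matrix.mul_assoc C, Matrix.trace_mul_comm C, Matrix.mul_assoc, Matrix.mul_assoc]
  ring

end Trace

end LocalGeom

/-! ### Christoffel symbols of a warped product. -/

namespace LocalGeom

section WarpedMat

variable {E F ι κ : Type*}

/-- The matrix of the warped product metric in product coordinates. -/
def warpedMat (gB : E → Matrix ι ι ℝ) (gF : F → Matrix κ κ ℝ) (f : E → ℝ) (z : E × F) :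
    Matrix (ι ⊕ κ) (ι ⊕ κ) ℝ :=
  Matrix.fromBlocks (gB z.1) 0 0 (f z.1 • gF z.2)

variable {gB : E → Matrix ι ι ℝ} {gF : F → Matrix κ κ ℝ} {f : E → ℝ}

theorem warpedMat_bb (z : E × F) (a c : ι) :
    warpedMat gB gF f z (Sum.inl a) (Sum.inl c) = gB z.1 a c := rfl

theorem warpedMat_bf (z : E × F) (a : ι) (γ : κ) :
    warpedMat gB gF f z (Sum.inl a) (Sum.inr γ) = 0 := rfl

theorem warpedMat_fb (z : E × F) (a : ι) (γ : κ) :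
    warpedMat gB gF f z (Sum.inr γ) (Sum.inl a) = 0 := rfl

theorem warpedMat_ff (z : E × F) (α γ : κ) :
    warpedMat gB gF f z (Sum.inr α) (Sum.inr γ) = f z.1 * gF z.2 α γ := rfl

end WarpedMat

section Warped

variable {E F : Type*} [NormedAddCommGroup E] [NormedSpace ℝ E]
  [NormedAddCommGroup F] [NormedSpace ℝ F]
variable {ι κ : Type*} (bE : Module.Basis ι ℝ E) (bF : Module.Basis κ ℝ F)

theorem pderiv_inl_mul {φ : E → ℝ} {ψ : F → ℝ} {z : E × F} (hφ : DifferentiableAt ℝ φ z.1)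
    (hψ : DifferentiableAt ℝ ψ z.2) (i : ι) :
    pderiv (bE.prod bF) (Sum.inl i) (fun w => φ w.1 * ψ w.2) z = pderiv bE i φ z.1 * ψ z.2 := by
  have h1 : HasFDerivAt (fun w : E × F => φ w.1) _ z :=
    hφ.hasFDerivAt.comp z hasFDerivAt_fst
  have h2 : HasFDerivAt (fun w : E × F => ψ w.2) _ z :=
    hψ.hasFDerivAt.comp z hasFDerivAt_snd
  have h3 : fderiv ℝ (fun w : E × F => φ w.1 * ψ w.2) z = _ := (h1.mul h2).fderiv
  simp [pderiv, h3, mul_comm]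

theorem pderiv_inr_mul {φ : E → ℝ} {ψ : F → ℝ} {z : E × F} (hφ : DifferentiableAt ℝ φ z.1)
    (hψ : DifferentiableAt ℝ ψ z.2) (i : κ) :
    pderiv (bE.prod bF) (Sum.inr i) (fun w => φ w.1 * ψ w.2) z = φ z.1 * pderiv bF i ψ z.2 := by
  have h1 : HasFDerivAt (fun w : E × F => φ w.1) _ z :=
    hφ.hasFDerivAt.comp z hasFDerivAt_fst
  have h2 : HasFDerivAt (fun w : E × F => ψ w.2) _ z :=
    hψ.hasFDerivAt.comp z hasFDerivAt_snd
  have h3 : fderiv ℝ (fun w : E × F => φ w.1 * ψ w.2) z = _ := (h1.mul h2).fderiv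
  simp [pderiv, h3]

theorem pderiv_inl_fst {φ : E → ℝ} {z : E × F} (hφ : DifferentiableAt ℝ φ z.1) (i : ι) :
    pderiv (bE.prod bF) (Sum.inl i) (fun w => φ w.1) z = pderiv bE i φ z.1 := by
  simpa using pderiv_inl_mul bE bF (ψ := fun _ => 1) hφ (differentiableAt_const _) i

theorem pderiv_inr_fst {φ : E → ℝ} {z : E × F} (hφ : DifferentiableAt ℝ φ z.1) (i : κ) :
    pderiv (bE.prod bF) (Sum.inr i) (fun w => φ w.1) z = 0 := by
  simpa [pderiv_const] using
    pderiv_inr_mul bE bF (ψ := fun _ => 1) hφ (differentiableAt_const _) i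

variable {gB : E → Matrix ι ι ℝ} {gF : F → Matrix κ κ ℝ} {f : E → ℝ} {U : Set E} {V : Set F}
  {z : E × F}

theorem WarpData.pderiv_mixed (i : ι ⊕ κ) (a : ι) (γ : κ) :
    pderiv (bE.prod bF) i (fun w => warpedMat gB gF f w (Sum.inl a) (Sum.inr γ)) z = 0 :=
  pderiv_const _ 0 i z

theorem WarpData.pderiv_mixed' (i : ι ⊕ κ) (a : ι) (γ : κ) :
    pderiv (bE.prod bF) i (fun w => warpedMat gB gF f w (Sum.inr γ) (Sum.inl a)) z = 0 :=
  pderiv_const _ 0 i z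

theorem contDiffOn_comp_fst {φ : E → ℝ} (V : Set F) (hφ : ContDiffOn ℝ ∞ φ U) :
    ContDiffOn ℝ ∞ (fun w : E × F => φ w.1) (U ×ˢ V) :=
  hφ.comp contDiffOn_fst fun _ hw => hw.1

theorem contDiffOn_comp_snd {ψ : F → ℝ} (U : Set E) (hψ : ContDiffOn ℝ ∞ ψ V) :
    ContDiffOn ℝ ∞ (fun w : E × F => ψ w.2) (U ×ˢ V) :=
  hψ.comp contDiffOn_snd fun _ hw => hw.2

variable [Fintype ι] [DecidableEq ι] [Fintype κ] [DecidableEq κ]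

/-- The `c`-th component of the gradient of `f`. -/
noncomputable def gradComp (gB : E → Matrix ι ι ℝ) (f : E → ℝ) (c : ι) (u : E) : ℝ :=
  ∑ a, (gB u)⁻¹ c a * pderiv bE a f u

/-- Coordinate data of a warped product. -/
structure WarpData (gB : E → Matrix ι ι ℝ) (gF : F → Matrix κ κ ℝ) (f : E → ℝ) (U : Set E)
    (V : Set F) : Prop where
  base : SmoothMetricOn gB U
  fiber : SmoothMetricOn gF V
  smooth : ContDiffOn ℝ ∞ f U
  ne_zero : ∀ u ∈ U, f u ≠ 0

namespace WarpData

theorem f_diff (h : WarpData gB gF f U V) (hz : z.1 ∈ U) : DifferentiableAt ℝ f z.1 := h.base.diff h.smooth hz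

theorem mul_inv_blocks (h : WarpData gB gF f U V) (hz : z ∈ U ×ˢ V) :
    warpedMat gB gF f z
      * Matrix.fromBlocks (gB z.1)⁻¹ 0 0 ((f z.1)⁻¹ • (gF z.2)⁻¹) = 1 := by
  simp [warpedMat, Matrix.fromBlocks_multiply, h.base.mul_inv hz.1, h.fiber.mul_inv hz.2,
    h.ne_zero _ hz.1, smul_smul]

theorem inv_blocks (h : WarpData gB gF f U V) (hz : z ∈ U ×ˢ V) :
    (warpedMat gB gF f z)⁻¹ = Matrix.fromBlocks (gB z.1)⁻¹ 0 0 ((f z.1)⁻¹ • (gF z.2)⁻¹) :=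
  Matrix.inv_eq_right_inv (h.mul_inv_blocks hz)

theorem total (h : WarpData gB gF f U V) : SmoothMetricOn (warpedMat gB gF f) (U ×ˢ V) where
  isOpen := h.base.isOpen.prod h.fiber.isOpen
  symm z hz := by
    simp [warpedMat, Matrix.fromBlocks_transpose, h.base.symm _ hz.1, h.fiber.symm _ hz.2]
  det z hz := Matrix.isUnit_det_of_right_inverse (h.mul_inv_blocks hz)
  smooth i j := by
    rcases i with a | α <;> rcases j with c | γ
    · exact contDiffOn_comp_fst V (h.base.smooth a c)
    · exact contDiffOn_const
    · exact contDiffOn_const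
    · exact (contDiffOn_comp_fst V h.smooth).mul (contDiffOn_comp_snd U (h.fiber.smooth α γ))

section Christoffel

variable (h : WarpData gB gF f U V) (hz : z ∈ U ×ˢ V)
include h hz

theorem pderiv_inl_base (i a c : ι) :
    pderiv (bE.prod bF) (Sum.inl i) (fun w => warpedMat gB gF f w (Sum.inl a) (Sum.inl c)) z
      = pderiv bE i (fun u => gB u a c) z.1 :=
  pderiv_inl_fst bE bF (φ := fun u => gB u a c) (h.base.diff (h.base.smooth a c) hz.1) i

theorem pderiv_inr_base (i : κ) (a c : ι) :
    pderiv (bE.prod bF) (Sum.inr i) (fun w => warpedMat gB gF f w (Sum.inl a) (Sum.inl c)) z = 0 :=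
  pderiv_inr_fst bE bF (φ := fun u => gB u a c) (h.base.diff (h.base.smooth a c) hz.1) i

theorem pderiv_inl_fiber (i : ι) (α γ : κ) :
    pderiv (bE.prod bF) (Sum.inl i) (fun w => warpedMat gB gF f w (Sum.inr α) (Sum.inr γ)) z
      = pderiv bE i f z.1 * gF z.2 α γ :=
  pderiv_inl_mul bE bF (φ := f) (ψ := fun u => gF u α γ) (h.f_diff hz.1)
    (h.fiber.diff (h.fiber.smooth α γ) hz.2) i

theorem pderiv_inr_fiber (i α γ : κ) :
    pderiv (bE.prod bF) (Sum.inr i) (fun w => warpedMat gB gF f w (Sum.inr α) (Sum.inr γ)) z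
      = f z.1 * pderiv bF i (fun u => gF u α γ) z.2 :=
  pderiv_inr_mul bE bF (φ := f) (ψ := fun u => gF u α γ) (h.f_diff hz.1)
    (h.fiber.diff (h.fiber.smooth α γ) hz.2) i

/-- In these suffixes b stands for a base index and f for a fiber index, with the upper index first;
for $R$ and $\nabla R$ the letters follow the order of the indices, and a detached last letter is
the direction of differentiation. -/
theorem christoffel_bbb (d a c : ι) :
    christoffel (bE.prod bF) (warpedMat gB gF f) (Sum.inl d) (Sum.inl a) (Sum.inl c) z
      = christoffel bE gB d a c z.1 := by
  simp [christoffel, h.inv_blocks hz, Fintype.sum_sum_type, h.pderiv_inl_base bE bF hz]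

theorem christoffel_bbf (d a : ι) (γ : κ) :
    christoffel (bE.prod bF) (warpedMat gB gF f) (Sum.inl d) (Sum.inl a) (Sum.inr γ) z = 0 := by
  simp [christoffel, h.inv_blocks hz, Fintype.sum_sum_type, h.pderiv_inr_base bE bF hz,
    pderiv_mixed', pderiv_mixed]

theorem christoffel_bff (d : ι) (β γ : κ) :
    christoffel (bE.prod bF) (warpedMat gB gF f) (Sum.inl d) (Sum.inr β) (Sum.inr γ) z
      = (-(1 / 2) * gradComp bE gB f d z.1) * gF z.2 β γ := by
  simp only [christoffel, h.inv_blocks hz, Fintype.sum_sum_type, h.pderiv_inl_fiber bE bF hz,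
    pderiv_mixed', gradComp, Matrix.fromBlocks_apply₁₁, Matrix.fromBlocks_apply₁₂,
    Matrix.zero_apply, zero_mul, Finset.sum_const_zero, add_zero, zero_sub, Finset.mul_sum,
    Finset.sum_mul]
  exact Finset.sum_congr rfl fun a _ => by ring

theorem christoffel_fbb (δ : κ) (a c : ι) :
    christoffel (bE.prod bF) (warpedMat gB gF f) (Sum.inr δ) (Sum.inl a) (Sum.inl c) z = 0 := by
  simp [christoffel, h.inv_blocks hz, Fintype.sum_sum_type, h.pderiv_inr_base bE bF hz,
    pderiv_mixed]

theorem christoffel_fbf (δ : κ) (a : ι) (β : κ) :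
    christoffel (bE.prod bF) (warpedMat gB gF f) (Sum.inr δ) (Sum.inl a) (Sum.inr β) z
      = pderiv bE a f z.1 / (2 * f z.1) * (1 : Matrix κ κ ℝ) δ β := by
  simp only [christoffel, h.inv_blocks hz, Fintype.sum_sum_type, h.pderiv_inl_fiber bE bF hz,
    pderiv_mixed', pderiv_mixed, Matrix.fromBlocks_apply₂₁, Matrix.fromBlocks_apply₂₂,
    Matrix.zero_apply, zero_mul, Finset.sum_const_zero, add_zero, zero_add, sub_zero,
    ← h.fiber.inv_mul hz.2, Matrix.mul_apply, Finset.mul_sum, Matrix.smul_apply, smul_eq_mul]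
  refine Finset.sum_congr rfl fun l _ => ?_
  rw [h.fiber.symm_apply hz.2 β l]
  have := h.ne_zero _ hz.1
  field_simp

theorem christoffel_fff (δ β γ : κ) :
    christoffel (bE.prod bF) (warpedMat gB gF f) (Sum.inr δ) (Sum.inr β) (Sum.inr γ) z
      = christoffel bF gF δ β γ z.2 := by
  simp only [christoffel, h.inv_blocks hz, Fintype.sum_sum_type, h.pderiv_inr_fiber bE bF hz,
    pderiv_mixed', Matrix.fromBlocks_apply₂₁, Matrix.fromBlocks_apply₂₂,
    Matrix.zero_apply, zero_mul, Finset.sum_const_zero, zero_add,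
    Finset.mul_sum, Matrix.smul_apply, smul_eq_mul]
  refine Finset.sum_congr rfl fun l _ => ?_
  have := h.ne_zero _ hz.1
  field_simp

theorem christoffel_bfb (d a : ι) (γ : κ) :
    christoffel (bE.prod bF) (warpedMat gB gF f) (Sum.inl d) (Sum.inr γ) (Sum.inl a) z = 0 := by
  rw [h.total.christoffel_symm _ hz, h.christoffel_bbf bE bF hz]

theorem christoffel_ffb (δ : κ) (a : ι) (β : κ) :
    christoffel (bE.prod bF) (warpedMat gB gF f) (Sum.inr δ) (Sum.inr β) (Sum.inl a) z
      = pderiv bE a f z.1 / (2 * f z.1) * (1 : Matrix κ κ ℝ) δ β := by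
  rw [h.total.christoffel_symm _ hz, h.christoffel_fbf bE bF hz]

end Christoffel

end WarpData

end Warped

end LocalGeom

/-! ### The tensors of the warping function and the curvature of a warped product. -/

namespace LocalGeom

section FunctionTensors

variable {E : Type*} [NormedAddCommGroup E] [NormedSpace ℝ E]
variable {ι : Type*} [Fintype ι] [DecidableEq ι] (b : Module.Basis ι ℝ E)
variable {G : E → Matrix ι ι ℝ} {f : E → ℝ} {U : Set E} {u : E}

theorem sum_gradComp (hf : f u ≠ 0) :
    ∑ c, gradComp b G f c u * pderiv b c f u = 4 * f u ^ 2 * warpP b G f u := by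
  simp only [gradComp, warpP, Finset.sum_mul]
  rw [← mul_assoc, mul_one_div_cancel (by positivity), one_mul]
  exact Finset.sum_congr rfl fun i _ => Finset.sum_congr rfl fun j _ => by ring

/-- The quotient $f_a/(2f)$ is the coefficient in $\Gamma^\delta_{a\beta}$. Its derivative is where
$T$ enters the curvature; the other two terms are set against the quadratic Christoffel terms. -/
theorem pderiv_half_log (hU : IsOpen U) (hf : ContDiffOn ℝ ∞ f U) (hu : u ∈ U) (h0 : f u ≠ 0)
    (a i : ι) :
    pderiv b i (fun w => pderiv b a f w / (2 * f w)) u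
      = warpT b G f u a i + (∑ c, christoffel b G c i a u * pderiv b c f u) / (2 * f u)
        - pderiv b a f u * pderiv b i f u / (4 * f u ^ 2) := by
  have df := differentiableAt_of_contDiffOn hU hf hu
  have dfa := differentiableAt_of_contDiffOn hU (contDiffOn_pderiv b hU hf a) hu
  rw [pderiv_div b dfa (df.const_mul 2) (by simpa using h0), pderiv_const_mul b _ df]
  simp only [warpT, Matrix.of_apply]
  field_simp
  ring

namespace SmoothMetricOn

theorem warpT_symm (h : SmoothMetricOn G U) (hf : ContDiffOn ℝ ∞ f U) (hu : u ∈ U) (i j : ι) :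
    warpT b G f u i j = warpT b G f u j i := by
  simp only [warpT, Matrix.of_apply]
  rw [pderiv_comm b h.isOpen hf hu j i]
  simp only [h.christoffel_symm b hu _ j i]
  ring

theorem smooth_warpT (h : SmoothMetricOn G U) (hf : ContDiffOn ℝ ∞ f U) (h0 : ∀ u ∈ U, f u ≠ 0)
    (i j : ι) : ContDiffOn ℝ ∞ (fun u => warpT b G f u i j) U := by
  have hd := fun i => contDiffOn_pderiv b h.isOpen hf i
  have hq : ContDiffOn ℝ ∞ (fun u => 1 / (2 * f u)) U :=
    contDiffOn_const.div (contDiffOn_const.mul hf) fun u hu => by simpa using h0 u hu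
  simp only [warpT, Matrix.of_apply]
  exact hq.mul (((contDiffOn_pderiv b h.isOpen (hd i) j).sub
    (ContDiffOn.sum fun c _ => (h.smooth_christoffel b c j i).mul (hd c))).sub
      (hq.mul ((hd i).mul (hd j))))

theorem smooth_warpP (h : SmoothMetricOn G U) (hf : ContDiffOn ℝ ∞ f U) (h0 : ∀ u ∈ U, f u ≠ 0) :
    ContDiffOn ℝ ∞ (warpP b G f) U := by
  have hd := fun i => contDiffOn_pderiv b h.isOpen hf i
  have hq : ContDiffOn ℝ ∞ (fun u => 1 / (4 * f u ^ 2)) U :=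
    contDiffOn_const.div (contDiffOn_const.mul (hf.pow 2)) fun u hu => by simpa using h0 u hu
  unfold warpP
  exact hq.mul (ContDiffOn.sum fun i _ => ContDiffOn.sum fun j _ =>
    (h.smooth_inv i j).mul ((hd i).mul (hd j)))

end SmoothMetricOn

end FunctionTensors

section Warped

variable {E F : Type*} [NormedAddCommGroup E] [NormedSpace ℝ E]
  [NormedAddCommGroup F] [NormedSpace ℝ F]
variable {ι κ : Type*} (bE : Module.Basis ι ℝ E) (bF : Module.Basis κ ℝ F)
variable {gB : E → Matrix ι ι ℝ} {gF : F → Matrix κ κ ℝ} {f : E → ℝ} {U : Set E} {V : Set F}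
  {z : E × F}

/-- Almost every component to be differentiated is zero or a product of a function on the base and
one on the fiber, throughout $U\times V$; a coordinate derivative then acts on one factor. -/
theorem pderiv_inl_of_eqOn (hU : IsOpen U) (hV : IsOpen V) (hz : z ∈ U ×ˢ V) {χ : E × F → ℝ}
    {φ : E → ℝ} {ψ : F → ℝ} (hχ : ∀ w ∈ U ×ˢ V, χ w = φ w.1 * ψ w.2)
    (hφ : ContDiffOn ℝ ∞ φ U) (hψ : ContDiffOn ℝ ∞ ψ V) (i : ι) :
    pderiv (bE.prod bF) (Sum.inl i) χ z = pderiv bE i φ z.1 * ψ z.2 := by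
  have h : χ =ᶠ[nhds z] fun w => φ w.1 * ψ w.2 := by
    filter_upwards [(hU.prod hV).mem_nhds hz] with w hw using hχ w hw
  rw [pderiv_congr _ h, pderiv_inl_mul bE bF (differentiableAt_of_contDiffOn hU hφ hz.1)
    (differentiableAt_of_contDiffOn hV hψ hz.2)]

theorem pderiv_inr_of_eqOn (hU : IsOpen U) (hV : IsOpen V) (hz : z ∈ U ×ˢ V) {χ : E × F → ℝ}
    {φ : E → ℝ} {ψ : F → ℝ} (hχ : ∀ w ∈ U ×ˢ V, χ w = φ w.1 * ψ w.2)
    (hφ : ContDiffOn ℝ ∞ φ U) (hψ : ContDiffOn ℝ ∞ ψ V) (i : κ) :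
    pderiv (bE.prod bF) (Sum.inr i) χ z = φ z.1 * pderiv bF i ψ z.2 := by
  have h : χ =ᶠ[nhds z] fun w => φ w.1 * ψ w.2 := by
    filter_upwards [(hU.prod hV).mem_nhds hz] with w hw using hχ w hw
  rw [pderiv_congr _ h, pderiv_inr_mul bE bF (differentiableAt_of_contDiffOn hU hφ hz.1)
    (differentiableAt_of_contDiffOn hV hψ hz.2)]

theorem pderiv_of_eqOn_zero (hU : IsOpen U) (hV : IsOpen V) (hz : z ∈ U ×ˢ V) {χ : E × F → ℝ}
    (hχ : ∀ w ∈ U ×ˢ V, χ w = 0) (i : ι ⊕ κ) : pderiv (bE.prod bF) i χ z = 0 := by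
  have h : χ =ᶠ[nhds z] fun _ => 0 := by
    filter_upwards [(hU.prod hV).mem_nhds hz] with w hw using hχ w hw
  rw [pderiv_congr _ h, pderiv_const]

variable [Fintype ι] [DecidableEq ι] [Fintype κ] [DecidableEq κ]

namespace WarpData

section ChristoffelDerivatives

theorem smooth_half_log (h : WarpData gB gF f U V) (a : ι) :
    ContDiffOn ℝ ∞ (fun u => pderiv bE a f u / (2 * f u)) U :=
  (contDiffOn_pderiv bE h.base.isOpen h.smooth a).div (contDiffOn_const.mul h.smooth)
    fun u hu => by simpa using h.ne_zero u hu

variable (h : WarpData gB gF f U V) (hz : z ∈ U ×ˢ V)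
include h hz

theorem pderiv_inl_christoffel_bbb (i d a c : ι) :
    pderiv (bE.prod bF) (Sum.inl i) (christoffel (bE.prod bF) (warpedMat gB gF f)
      (Sum.inl d) (Sum.inl a) (Sum.inl c)) z = pderiv bE i (christoffel bE gB d a c) z.1 := by
  rw [pderiv_inl_of_eqOn bE bF h.base.isOpen h.fiber.isOpen hz
    (φ := christoffel bE gB d a c) (ψ := fun _ => 1)
    (fun w hw => by rw [h.christoffel_bbb bE bF hw, mul_one])
    (h.base.smooth_christoffel bE _ _ _) contDiffOn_const, mul_one]

theorem pderiv_inr_christoffel_bbb (i : κ) (d a c : ι) :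
    pderiv (bE.prod bF) (Sum.inr i) (christoffel (bE.prod bF) (warpedMat gB gF f)
      (Sum.inl d) (Sum.inl a) (Sum.inl c)) z = 0 := by
  rw [pderiv_inr_of_eqOn bE bF h.base.isOpen h.fiber.isOpen hz
    (φ := christoffel bE gB d a c) (ψ := fun _ => 1)
    (fun w hw => by rw [h.christoffel_bbb bE bF hw, mul_one])
    (h.base.smooth_christoffel bE _ _ _) contDiffOn_const, pderiv_const, mul_zero]

theorem pderiv_christoffel_bfb (i : ι ⊕ κ) (d a : ι) (γ : κ) :
    pderiv (bE.prod bF) i (christoffel (bE.prod bF) (warpedMat gB gF f)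
      (Sum.inl d) (Sum.inr γ) (Sum.inl a)) z = 0 :=
  pderiv_of_eqOn_zero bE bF h.base.isOpen h.fiber.isOpen hz
    (fun _ hw => h.christoffel_bfb bE bF hw d a γ) i

theorem pderiv_christoffel_fbb (i : ι ⊕ κ) (δ : κ) (a c : ι) :
    pderiv (bE.prod bF) i (christoffel (bE.prod bF) (warpedMat gB gF f)
      (Sum.inr δ) (Sum.inl a) (Sum.inl c)) z = 0 :=
  pderiv_of_eqOn_zero bE bF h.base.isOpen h.fiber.isOpen hz
    (fun _ hw => h.christoffel_fbb bE bF hw δ a c) i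

theorem pderiv_inl_christoffel_fbf (i : ι) (δ : κ) (a : ι) (β : κ) :
    pderiv (bE.prod bF) (Sum.inl i) (christoffel (bE.prod bF) (warpedMat gB gF f)
      (Sum.inr δ) (Sum.inl a) (Sum.inr β)) z
      = pderiv bE i (fun u => pderiv bE a f u / (2 * f u)) z.1 * (1 : Matrix κ κ ℝ) δ β :=
  pderiv_inl_of_eqOn bE bF h.base.isOpen h.fiber.isOpen hz (ψ := fun _ => (1 : Matrix κ κ ℝ) δ β)
    (fun _ hw => h.christoffel_fbf bE bF hw δ a β) (h.smooth_half_log bE a) contDiffOn_const i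

theorem pderiv_inr_christoffel_fbf (i : κ) (δ : κ) (a : ι) (β : κ) :
    pderiv (bE.prod bF) (Sum.inr i) (christoffel (bE.prod bF) (warpedMat gB gF f)
      (Sum.inr δ) (Sum.inl a) (Sum.inr β)) z = 0 := by
  rw [pderiv_inr_of_eqOn bE bF h.base.isOpen h.fiber.isOpen hz
    (ψ := fun _ => (1 : Matrix κ κ ℝ) δ β) (fun _ hw => h.christoffel_fbf bE bF hw δ a β)
    (h.smooth_half_log bE a) contDiffOn_const i, pderiv_const, mul_zero]

theorem pderiv_inl_christoffel_ffb (i : ι) (δ : κ) (a : ι) (β : κ) :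
    pderiv (bE.prod bF) (Sum.inl i) (christoffel (bE.prod bF) (warpedMat gB gF f)
      (Sum.inr δ) (Sum.inr β) (Sum.inl a)) z
      = pderiv bE i (fun u => pderiv bE a f u / (2 * f u)) z.1 * (1 : Matrix κ κ ℝ) δ β :=
  pderiv_inl_of_eqOn bE bF h.base.isOpen h.fiber.isOpen hz (ψ := fun _ => (1 : Matrix κ κ ℝ) δ β)
    (fun _ hw => h.christoffel_ffb bE bF hw δ a β) (h.smooth_half_log bE a) contDiffOn_const i

theorem pderiv_inr_christoffel_ffb (i : κ) (δ : κ) (a : ι) (β : κ) :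
    pderiv (bE.prod bF) (Sum.inr i) (christoffel (bE.prod bF) (warpedMat gB gF f)
      (Sum.inr δ) (Sum.inr β) (Sum.inl a)) z = 0 := by
  rw [pderiv_inr_of_eqOn bE bF h.base.isOpen h.fiber.isOpen hz
    (ψ := fun _ => (1 : Matrix κ κ ℝ) δ β) (fun _ hw => h.christoffel_ffb bE bF hw δ a β)
    (h.smooth_half_log bE a) contDiffOn_const i, pderiv_const, mul_zero]

theorem pderiv_inl_christoffel_fff (i : ι) (δ β γ : κ) :
    pderiv (bE.prod bF) (Sum.inl i) (christoffel (bE.prod bF) (warpedMat gB gF f)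
      (Sum.inr δ) (Sum.inr β) (Sum.inr γ)) z = 0 := by
  rw [pderiv_inl_of_eqOn bE bF h.base.isOpen h.fiber.isOpen hz
    (φ := fun _ => 1) (ψ := christoffel bF gF δ β γ)
    (fun w hw => by rw [h.christoffel_fff bE bF hw, one_mul])
    contDiffOn_const (h.fiber.smooth_christoffel bF _ _ _), pderiv_const, zero_mul]

theorem pderiv_inr_christoffel_fff (i δ β γ : κ) :
    pderiv (bE.prod bF) (Sum.inr i) (christoffel (bE.prod bF) (warpedMat gB gF f)
      (Sum.inr δ) (Sum.inr β) (Sum.inr γ)) z = pderiv bF i (christoffel bF gF δ β γ) z.2 := by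
  rw [pderiv_inr_of_eqOn bE bF h.base.isOpen h.fiber.isOpen hz
    (φ := fun _ => 1) (ψ := christoffel bF gF δ β γ)
    (fun w hw => by rw [h.christoffel_fff bE bF hw, one_mul])
    contDiffOn_const (h.fiber.smooth_christoffel bF _ _ _), one_mul]

end ChristoffelDerivatives

section Riemann

variable (h : WarpData gB gF f U V) (hz : z ∈ U ×ˢ V)

theorem riem_base_last (z : E × F) (i j k : ι ⊕ κ) (d : ι) :
    riem (bE.prod bF) (warpedMat gB gF f) i j k (Sum.inl d) z
      = ∑ c, gB z.1 d c * riemUp (bE.prod bF) (warpedMat gB gF f) (Sum.inl c) i j k z := by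
  simp [riem, Fintype.sum_sum_type, warpedMat_bb, warpedMat_bf]

theorem riem_fiber_last (z : E × F) (i j k : ι ⊕ κ) (δ : κ) :
    riem (bE.prod bF) (warpedMat gB gF f) i j k (Sum.inr δ) z
      = f z.1 * ∑ γ, gF z.2 δ γ
          * riemUp (bE.prod bF) (warpedMat gB gF f) (Sum.inr γ) i j k z := by
  simp [riem, Fintype.sum_sum_type, warpedMat_ff, warpedMat_fb, Finset.mul_sum, mul_assoc]

include h hz

theorem riem_bbbb (a b c d : ι) :
    riem (bE.prod bF) (warpedMat gB gF f) (Sum.inl a) (Sum.inl b) (Sum.inl c) (Sum.inl d) z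
      = riem bE gB a b c d z.1 := by
  rw [riem_base_last]
  refine Finset.sum_congr rfl fun s _ => ?_
  congr 1
  simp [riemUp, Fintype.sum_sum_type, h.christoffel_bbb bE bF hz, h.christoffel_bbf bE bF hz,
    h.christoffel_fbb bE bF hz, h.pderiv_inl_christoffel_bbb bE bF hz]

theorem riem_bbbf (a b c : ι) (δ : κ) :
    riem (bE.prod bF) (warpedMat gB gF f) (Sum.inl a) (Sum.inl b) (Sum.inl c) (Sum.inr δ) z
      = 0 := by
  rw [riem_fiber_last]
  refine mul_eq_zero_of_right _ (Finset.sum_eq_zero fun s _ => mul_eq_zero_of_right _ ?_)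
  simp [riemUp, Fintype.sum_sum_type, h.christoffel_fbb bE bF hz,
    h.pderiv_christoffel_fbb bE bF hz]

/-- Components ending in a fiber and a base index are taken from skewness in the last pair; thus
derivatives of $\Gamma^d_{\beta\gamma}$ are never required. -/
theorem riem_bbfb (a b c : ι) (δ : κ) :
    riem (bE.prod bF) (warpedMat gB gF f) (Sum.inl a) (Sum.inl b) (Sum.inr δ) (Sum.inl c) z
      = 0 := by
  rw [h.total.riem_skew _ hz, h.riem_bbbf bE bF hz, neg_zero]

theorem riem_bfbb (a b c : ι) (δ : κ) :
    riem (bE.prod bF) (warpedMat gB gF f) (Sum.inl a) (Sum.inr δ) (Sum.inl b) (Sum.inl c) z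
      = 0 := by
  rw [riem_base_last]
  refine Finset.sum_eq_zero fun s _ => mul_eq_zero_of_right _ ?_
  simp [riemUp, Fintype.sum_sum_type, h.christoffel_fbb bE bF hz, h.christoffel_bfb bE bF hz,
    h.christoffel_bbf bE bF hz, h.pderiv_christoffel_bfb bE bF hz,
    h.pderiv_inr_christoffel_bbb bE bF hz]

theorem riem_bbff (a b : ι) (γ δ : κ) :
    riem (bE.prod bF) (warpedMat gB gF f) (Sum.inl a) (Sum.inl b) (Sum.inr γ) (Sum.inr δ) z
      = 0 := by
  rw [riem_fiber_last]
  refine mul_eq_zero_of_right _ (Finset.sum_eq_zero fun s _ => mul_eq_zero_of_right _ ?_)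
  have hp := fun a i => pderiv_half_log bE (G := gB) h.base.isOpen h.smooth hz.1
    (h.ne_zero _ hz.1) a i
  simp [riemUp, Fintype.sum_sum_type, h.christoffel_fbb bE bF hz, h.christoffel_bbf bE bF hz,
    h.christoffel_fbf bE bF hz, h.pderiv_inl_christoffel_fbf bE bF hz, hp, Matrix.one_apply]
  -- Only an antisymmetrization in $a,b$ of symmetric quantities remains.
  rw [h.base.warpT_symm bE h.smooth hz.1 b a]
  simp only [h.base.christoffel_symm bE hz.1 _ b a]
  split_ifs <;> ring

theorem riem_bfff (a : ι) (β γ δ : κ) :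
    riem (bE.prod bF) (warpedMat gB gF f) (Sum.inl a) (Sum.inr β) (Sum.inr γ) (Sum.inr δ) z
      = 0 := by
  rw [riem_fiber_last]
  refine mul_eq_zero_of_right _ (Finset.sum_eq_zero fun s _ => mul_eq_zero_of_right _ ?_)
  simp [riemUp, Fintype.sum_sum_type, h.christoffel_fbb bE bF hz, h.christoffel_bbf bE bF hz,
    h.christoffel_fbf bE bF hz, h.christoffel_fff bE bF hz, h.pderiv_inl_christoffel_fff bE bF hz,
    h.pderiv_inr_christoffel_fbf bE bF hz, Matrix.one_apply]
  ring

theorem riem_fbff (a : ι) (β γ δ : κ) :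
    riem (bE.prod bF) (warpedMat gB gF f) (Sum.inr β) (Sum.inl a) (Sum.inr γ) (Sum.inr δ) z
      = 0 := by
  rw [riem_antisymm, h.riem_bfff bE bF hz, neg_zero]

theorem riem_ffbf (c : ι) (α β δ : κ) :
    riem (bE.prod bF) (warpedMat gB gF f) (Sum.inr α) (Sum.inr β) (Sum.inl c) (Sum.inr δ) z
      = 0 := by
  rw [riem_fiber_last]
  refine mul_eq_zero_of_right _ (Finset.sum_eq_zero fun s _ => mul_eq_zero_of_right _ ?_)
  simp [riemUp, Fintype.sum_sum_type, h.christoffel_bfb bE bF hz, h.christoffel_ffb bE bF hz,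
    h.christoffel_fff bE bF hz, h.pderiv_inr_christoffel_ffb bE bF hz, Matrix.one_apply]
  rw [h.fiber.christoffel_symm bF hz.2 _ β α]
  ring

theorem riem_fffb (c : ι) (α β δ : κ) :
    riem (bE.prod bF) (warpedMat gB gF f) (Sum.inr α) (Sum.inr β) (Sum.inr δ) (Sum.inl c) z
      = 0 := by
  rw [h.total.riem_skew _ hz, h.riem_ffbf bE bF hz, neg_zero]

theorem riem_bfbf (a b : ι) (β δ : κ) :
    riem (bE.prod bF) (warpedMat gB gF f) (Sum.inl a) (Sum.inr β) (Sum.inl b) (Sum.inr δ) z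
      = f z.1 * warpT bE gB f z.1 a b * gF z.2 β δ := by
  have hp := fun a i => pderiv_half_log bE (G := gB) h.base.isOpen h.smooth hz.1
    (h.ne_zero _ hz.1) a i
  have hr : ∀ s, riemUp (bE.prod bF) (warpedMat gB gF f) (Sum.inr s) (Sum.inl a) (Sum.inr β)
      (Sum.inl b) z = warpT bE gB f z.1 a b * (1 : Matrix κ κ ℝ) s β := by
    intro s
    simp [riemUp, Fintype.sum_sum_type, h.christoffel_fbb bE bF hz, h.christoffel_bfb bE bF hz,
      h.christoffel_ffb bE bF hz, h.christoffel_fbf bE bF hz, h.christoffel_bbb bE bF hz,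
      h.pderiv_inl_christoffel_ffb bE bF hz, h.pderiv_christoffel_fbb bE bF hz, hp,
      Matrix.one_apply]
    rw [h.base.warpT_symm bE h.smooth hz.1 b a]
    split_ifs
    · simp only [Finset.sum_div, mul_div_assoc]
      ring
    · simp
  rw [riem_fiber_last]
  simp [hr, Matrix.one_apply]
  rw [h.fiber.symm_apply hz.2]
  ring

theorem riem_bffb (a b : ι) (β δ : κ) :
    riem (bE.prod bF) (warpedMat gB gF f) (Sum.inl a) (Sum.inr β) (Sum.inr δ) (Sum.inl b) z
      = -(f z.1 * warpT bE gB f z.1 a b * gF z.2 β δ) := by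
  rw [h.total.riem_skew _ hz, h.riem_bfbf bE bF hz]

theorem riem_fbbf (a b : ι) (β δ : κ) :
    riem (bE.prod bF) (warpedMat gB gF f) (Sum.inr β) (Sum.inl a) (Sum.inl b) (Sum.inr δ) z
      = -(f z.1 * warpT bE gB f z.1 a b * gF z.2 β δ) := by
  rw [riem_antisymm, h.riem_bfbf bE bF hz]

/-- The correction to $f\widetilde R$ comes from products of Christoffel symbols through a base
index $c$: $\sum_c\left(-\tfrac12f^c\right)\tfrac{f_c}{2f}=-fP$, and lowering the index gives
another factor $f$. -/
theorem riem_ffff (α β γ δ : κ) :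
    riem (bE.prod bF) (warpedMat gB gF f) (Sum.inr α) (Sum.inr β) (Sum.inr γ) (Sum.inr δ) z
      = f z.1 * riem bF gF α β γ δ z.2
        - 1 / 2 * (f z.1 ^ 2 * warpP bE gB f z.1) * kn (gF z.2) (gF z.2) α β γ δ := by
  have h0 := h.ne_zero _ hz.1
  have hP := sum_gradComp bE (G := gB) h0
  have hr : ∀ s, riemUp (bE.prod bF) (warpedMat gB gF f) (Sum.inr s) (Sum.inr α) (Sum.inr β)
      (Sum.inr γ) z = riemUp bF gF s α β γ z.2 - f z.1 * warpP bE gB f z.1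
        * (gF z.2 β γ * (1 : Matrix κ κ ℝ) s α - gF z.2 α γ * (1 : Matrix κ κ ℝ) s β) := by
    intro s
    have e : ∑ c, (-(1 / 2) * gradComp bE gB f c z.1 * gF z.2 β γ
          * (pderiv bE c f z.1 / (2 * f z.1) * (1 : Matrix κ κ ℝ) s α)
        - -(1 / 2) * gradComp bE gB f c z.1 * gF z.2 α γ
          * (pderiv bE c f z.1 / (2 * f z.1) * (1 : Matrix κ κ ℝ) s β))
        = -(f z.1 * warpP bE gB f z.1
        * (gF z.2 β γ * (1 : Matrix κ κ ℝ) s α - gF z.2 α γ * (1 : Matrix κ κ ℝ) s β)) := by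
      have e2 : f z.1 * warpP bE gB f z.1
          = (∑ c, gradComp bE gB f c z.1 * pderiv bE c f z.1) / (4 * f z.1) := by
        rw [hP]
        field_simp
      rw [e2, Finset.sum_div, Finset.sum_mul, ← Finset.sum_neg_distrib]
      refine Finset.sum_congr rfl fun c _ => ?_
      field_simp
      ring
    simp only [riemUp, Fintype.sum_sum_type, h.christoffel_bff bE bF hz,
      h.christoffel_ffb bE bF hz, h.christoffel_fff bE bF hz,
      h.pderiv_inr_christoffel_fff bE bF hz, e]
    ring
  rw [riem_fiber_last]
  simp only [hr, mul_sub, Finset.sum_sub_distrib, Matrix.one_apply, mul_ite, mul_one, mul_zero,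
    Finset.sum_ite_eq', Finset.mem_univ, if_true, riem, kn]
  rw [h.fiber.symm_apply hz.2 δ, h.fiber.symm_apply hz.2 δ]
  ring

end Riemann

end WarpData

end Warped

end LocalGeom

/-! ### Ricci tensor of a warped product and covariant derivative of its curvature. -/

namespace LocalGeom

section Parallel

variable {E : Type*} [NormedAddCommGroup E] [NormedSpace ℝ E]
variable {ι : Type*} [Fintype ι] [DecidableEq ι] (b : Module.Basis ι ℝ E)
variable {G : E → Matrix ι ι ℝ} {U : Set E} {u : E}

namespace SmoothMetricOn

theorem pderiv_metric (h : SmoothMetricOn G U) (hu : u ∈ U) (m k l : ι) :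
    pderiv b m (fun w => G w k l) u
      = ∑ s, (christoffel b G s m k u * G u s l + christoffel b G s m l u * G u k s) := by
  have e := congrFun (congrFun (h.pderivMat_metric b hu m) k) l
  simp only [pderivMat, christoffelMat, Matrix.of_apply, Matrix.add_apply, Matrix.mul_apply,
    Matrix.transpose_apply] at e
  rw [e, Finset.sum_add_distrib]
  congr 1
  exact Finset.sum_congr rfl fun s _ => mul_comm _ _

theorem smooth_kn (h : SmoothMetricOn G U) (i j k l : ι) :
    ContDiffOn ℝ ∞ (fun u => kn (G u) (G u) i j k l) U := by
  have hs := h.smooth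
  unfold kn
  exact (((hs i l).mul (hs j k)).add ((hs j k).mul (hs i l))).sub ((hs i k).mul (hs j l)) |>.sub
    ((hs j l).mul (hs i k))

/-- That is, $\nabla(g\wedge g)=0$. On the fiber it makes the $P$-term of the curvature drop out of
fiber derivatives. -/
theorem pderiv_kn (h : SmoothMetricOn G U) (hu : u ∈ U) (m i j k l : ι) :
    pderiv b m (fun w => kn (G w) (G w) i j k l) u
      = ∑ s, (christoffel b G s m i u * kn (G u) (G u) s j k l
        + christoffel b G s m j u * kn (G u) (G u) i s k l
        + christoffel b G s m k u * kn (G u) (G u) i j s l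
        + christoffel b G s m l u * kn (G u) (G u) i j k s) := by
  have hd : ∀ k l, DifferentiableAt ℝ (fun w => G w k l) u := fun k l => h.diff (h.smooth k l) hu
  have e : (fun w => kn (G w) (G w) i j k l)
      = fun w => 2 * (G w i l * G w j k - G w i k * G w j l) := by
    funext w
    simp only [kn]
    ring
  have h1 : DifferentiableAt ℝ (fun w => G w i l * G w j k) u := (hd i l).mul (hd j k)
  have h2 : DifferentiableAt ℝ (fun w => G w i k * G w j l) u := (hd i k).mul (hd j l)
  have h3 : DifferentiableAt ℝ (fun w => G w i l * G w j k - G w i k * G w j l) u := h1.sub h2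
  rw [e, pderiv_const_mul b _ h3, pderiv_sub b h1 h2, pderiv_mul b (hd i l) (hd j k),
    pderiv_mul b (hd i k) (hd j l)]
  simp only [h.pderiv_metric b hu, Finset.sum_mul, Finset.mul_sum, ← Finset.sum_add_distrib,
    ← Finset.sum_sub_distrib]
  refine Finset.sum_congr rfl fun s _ => ?_
  simp only [kn]
  ring

end SmoothMetricOn

end Parallel

section Warped

variable {E F : Type*} [NormedAddCommGroup E] [NormedSpace ℝ E]
  [NormedAddCommGroup F] [NormedSpace ℝ F]
variable {ι κ : Type*} (bE : Module.Basis ι ℝ E) (bF : Module.Basis κ ℝ F)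
variable {gB : E → Matrix ι ι ℝ} {gF : F → Matrix κ κ ℝ} {f : E → ℝ} {U : Set E} {V : Set F}
  {z : E × F}
variable [Fintype ι] [DecidableEq ι] [Fintype κ] [DecidableEq κ]

namespace WarpData

section

variable (h : WarpData gB gF f U V) (hz : z ∈ U ×ˢ V)
include h hz

theorem ricci_bb (a c : ι) :
    ricci (bE.prod bF) (warpedMat gB gF f) z (Sum.inl a) (Sum.inl c)
      = ricci bE gB z.1 a c - Fintype.card κ * warpT bE gB f z.1 a c := by
  have h0 := h.ne_zero _ hz.1
  rw [← sum_inv_mul_self (h.fiber.symm _ hz.2) (h.fiber.det _ hz.2)]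
  simp only [ricci, Matrix.of_apply, Fintype.sum_sum_type, h.inv_blocks hz,
    Matrix.fromBlocks_apply₁₁, Matrix.fromBlocks_apply₁₂, Matrix.fromBlocks_apply₂₁,
    Matrix.fromBlocks_apply₂₂, Matrix.zero_apply, zero_mul, Finset.sum_const_zero, add_zero,
    zero_add, h.riem_bbbb bE bF hz, h.riem_fbbf bE bF hz, Matrix.smul_apply, smul_eq_mul,
    sub_eq_add_neg, Finset.sum_mul, ← Finset.sum_neg_distrib]
  congr 1
  refine Finset.sum_congr rfl fun i _ => Finset.sum_congr rfl fun l _ => ?_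
  field_simp

theorem ricci_ff (β γ : κ) :
    ricci (bE.prod bF) (warpedMat gB gF f) z (Sum.inr β) (Sum.inr γ)
      = ricci bF gF z.2 β γ + warpQ bE gB f (Fintype.card κ) z.1 * gF z.2 β γ := by
  have h0 := h.ne_zero _ hz.1
  -- The contraction of $\widetilde g\wedge\widetilde g$ is $2(q-1)\widetilde g$, the source of the
  -- summand $(q-1)P$ in $Q$; the base trace of $R_{a\beta\gamma b}$ supplies the trace of $T$.
  have hk := contract_kn (h.fiber.symm _ hz.2) (h.fiber.det _ hz.2) (gF z.2) β γ
  rw [sum_inv_mul_self (h.fiber.symm _ hz.2) (h.fiber.det _ hz.2)] at hk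
  have e1 : ∑ i, ∑ l, (gB z.1)⁻¹ i l * -(f z.1 * warpT bE gB f z.1 i l * gF z.2 β γ)
      = -(f z.1 * gF z.2 β γ) * ∑ i, ∑ l, (gB z.1)⁻¹ i l * warpT bE gB f z.1 i l := by
    simp only [Finset.mul_sum]
    exact Finset.sum_congr rfl fun i _ => Finset.sum_congr rfl fun l _ => by ring
  have e2 : ∑ i, ∑ l, (f z.1)⁻¹ * (gF z.2)⁻¹ i l * (f z.1 * riem bF gF i β γ l z.2
        - 1 / 2 * (f z.1 ^ 2 * warpP bE gB f z.1) * kn (gF z.2) (gF z.2) i β γ l)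
      = ricci bF gF z.2 β γ - 1 / 2 * (f z.1 * warpP bE gB f z.1)
        * ∑ i, ∑ l, (gF z.2)⁻¹ i l * kn (gF z.2) (gF z.2) i β γ l := by
    simp only [ricci, Matrix.of_apply, Finset.mul_sum, ← Finset.sum_sub_distrib]
    refine Finset.sum_congr rfl fun i _ => Finset.sum_congr rfl fun l _ => ?_
    field_simp
  have e3 : ricci (bE.prod bF) (warpedMat gB gF f) z (Sum.inr β) (Sum.inr γ)
      = (∑ i, ∑ l, (gB z.1)⁻¹ i l * -(f z.1 * warpT bE gB f z.1 i l * gF z.2 β γ))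
        + ∑ i, ∑ l, (f z.1)⁻¹ * (gF z.2)⁻¹ i l * (f z.1 * riem bF gF i β γ l z.2
        - 1 / 2 * (f z.1 ^ 2 * warpP bE gB f z.1) * kn (gF z.2) (gF z.2) i β γ l) := by
    simp only [ricci, Matrix.of_apply, Fintype.sum_sum_type, h.inv_blocks hz,
      Matrix.fromBlocks_apply₁₁, Matrix.fromBlocks_apply₁₂, Matrix.fromBlocks_apply₂₁,
      Matrix.fromBlocks_apply₂₂, Matrix.zero_apply, zero_mul, Finset.sum_const_zero, add_zero,
      zero_add, h.riem_bffb bE bF hz, h.riem_ffff bE bF hz, Matrix.smul_apply, smul_eq_mul]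
  rw [e3, e1, e2, hk, warpQ]
  ring

theorem ricci_bf (a : ι) (γ : κ) :
    ricci (bE.prod bF) (warpedMat gB gF f) z (Sum.inl a) (Sum.inr γ) = 0 := by
  simp [ricci, Fintype.sum_sum_type, h.inv_blocks hz, h.riem_bbfb bE bF hz, h.riem_fbff bE bF hz]

theorem ricci_fb (a : ι) (γ : κ) :
    ricci (bE.prod bF) (warpedMat gB gF f) z (Sum.inr γ) (Sum.inl a) = 0 := by
  simp [ricci, Fintype.sum_sum_type, h.inv_blocks hz, h.riem_bfbb bE bF hz, h.riem_ffbf bE bF hz]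

/-- The slices $\overline M\times\{y\}$ are totally geodesic ($\Gamma^\delta_{ac}=0$), so no fiber
index enters. -/
theorem covRiem_bbbb_b (a b c d e : ι) :
    covRiem (bE.prod bF) (warpedMat gB gF f) (Sum.inl a) (Sum.inl b) (Sum.inl c) (Sum.inl d)
      (Sum.inl e) z = covRiem bE gB a b c d e z.1 := by
  have hp : pderiv (bE.prod bF) (Sum.inl e) (riem (bE.prod bF) (warpedMat gB gF f)
      (Sum.inl a) (Sum.inl b) (Sum.inl c) (Sum.inl d)) z
      = pderiv bE e (riem bE gB a b c d) z.1 := by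
    rw [pderiv_inl_of_eqOn bE bF h.base.isOpen h.fiber.isOpen hz (ψ := fun _ => 1)
      (fun w hw => by rw [h.riem_bbbb bE bF hw, mul_one]) (h.base.smooth_riem bE a b c d)
      contDiffOn_const, mul_one]
  simp [covRiem, Fintype.sum_sum_type, hp, h.christoffel_bbb bE bF hz, h.riem_bbbb bE bF hz,
    h.christoffel_fbb bE bF hz]

theorem riem_ffff_eventuallyEq (α β γ δ : κ) :
    riem (bE.prod bF) (warpedMat gB gF f) (Sum.inr α) (Sum.inr β) (Sum.inr γ) (Sum.inr δ)
      =ᶠ[nhds z] fun w => f w.1 * riem bF gF α β γ δ w.2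
        - 1 / 2 * (f w.1 ^ 2 * warpP bE gB f w.1) * kn (gF w.2) (gF w.2) α β γ δ := by
  filter_upwards [h.total.isOpen.mem_nhds hz] with w hw using h.riem_ffff bE bF hw α β γ δ

omit hz in
theorem smooth_normSq :
    ContDiffOn ℝ ∞ (fun u => 1 / 2 * (f u ^ 2 * warpP bE gB f u)) U :=
  contDiffOn_const.mul ((h.smooth.pow 2).mul (h.base.smooth_warpP bE h.smooth h.ne_zero))

theorem differentiableAt_riem_ffff_left (α β γ δ : κ) :
    DifferentiableAt ℝ (fun w : E × F => f w.1 * riem bF gF α β γ δ w.2) z :=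
  h.total.diff ((contDiffOn_comp_fst V h.smooth).mul
    (contDiffOn_comp_snd U (h.fiber.smooth_riem bF α β γ δ))) hz

theorem differentiableAt_riem_ffff_right (α β γ δ : κ) :
    DifferentiableAt ℝ (fun w : E × F => 1 / 2 * (f w.1 ^ 2 * warpP bE gB f w.1)
      * kn (gF w.2) (gF w.2) α β γ δ) z :=
  h.total.diff ((contDiffOn_comp_fst V (h.smooth_normSq bE)).mul
    (contDiffOn_comp_snd U (h.fiber.smooth_kn α β γ δ))) hz

theorem covRiem_ffff_f (α β γ δ ε : κ) :
    covRiem (bE.prod bF) (warpedMat gB gF f) (Sum.inr α) (Sum.inr β) (Sum.inr γ) (Sum.inr δ)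
      (Sum.inr ε) z = f z.1 * covRiem bF gF α β γ δ ε z.2 := by
  have hp : pderiv (bE.prod bF) (Sum.inr ε) (riem (bE.prod bF) (warpedMat gB gF f)
      (Sum.inr α) (Sum.inr β) (Sum.inr γ) (Sum.inr δ)) z
      = f z.1 * pderiv bF ε (riem bF gF α β γ δ) z.2
        - 1 / 2 * (f z.1 ^ 2 * warpP bE gB f z.1)
          * pderiv bF ε (fun w => kn (gF w) (gF w) α β γ δ) z.2 := by
    rw [pderiv_congr _ (h.riem_ffff_eventuallyEq bE bF hz α β γ δ),
      pderiv_sub _ (h.differentiableAt_riem_ffff_left bF hz α β γ δ)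
        (h.differentiableAt_riem_ffff_right bE hz α β γ δ),
      pderiv_inr_mul bE bF (φ := f) (ψ := riem bF gF α β γ δ) (h.f_diff hz.1)
        (h.fiber.diff (h.fiber.smooth_riem bF _ _ _ _) hz.2),
      pderiv_inr_mul bE bF (φ := fun u => 1 / 2 * (f u ^ 2 * warpP bE gB f u))
        (ψ := fun w => kn (gF w) (gF w) α β γ δ) (h.base.diff (h.smooth_normSq bE) hz.1)
        (h.fiber.diff (h.fiber.smooth_kn _ _ _ _) hz.2)]
  simp only [covRiem, hp, h.fiber.pderiv_kn bF hz.2, Fintype.sum_sum_type,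
    h.christoffel_bff bE bF hz, h.christoffel_fff bE bF hz, h.riem_bfff bE bF hz,
    h.riem_fbff bE bF hz, h.riem_ffbf bE bF hz, h.riem_fffb bE bF hz, h.riem_ffff bE bF hz,
    mul_zero, add_zero, Finset.sum_const_zero, zero_add, mul_sub, Finset.mul_sum]
  rw [sub_sub, ← Finset.sum_add_distrib]
  congr 1
  exact Finset.sum_congr rfl fun s _ => by ring

/-- Differentiating $f\widetilde R$ gives $+f_a\widetilde R$; each of the four slots contributes
$-\tfrac{f_a}{2f}f\widetilde R$, leaving $-f_a\widetilde R$. The coefficient of $\widetilde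
g\wedge\widetilde g$ is irrelevant later. -/
theorem exists_covRiem_ffff_b (a : ι) : ∃ c : ℝ, ∀ α β γ δ,
    covRiem (bE.prod bF) (warpedMat gB gF f) (Sum.inr α) (Sum.inr β) (Sum.inr γ) (Sum.inr δ)
      (Sum.inl a) z
      = -(pderiv bE a f z.1) * riem bF gF α β γ δ z.2 + c * kn (gF z.2) (gF z.2) α β γ δ := by
  refine ⟨-pderiv bE a (fun u => 1 / 2 * (f u ^ 2 * warpP bE gB f u)) z.1
    + pderiv bE a f z.1 * (f z.1 * warpP bE gB f z.1), fun α β γ δ => ?_⟩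
  have h0 := h.ne_zero _ hz.1
  have hp : pderiv (bE.prod bF) (Sum.inl a) (riem (bE.prod bF) (warpedMat gB gF f)
      (Sum.inr α) (Sum.inr β) (Sum.inr γ) (Sum.inr δ)) z
      = pderiv bE a f z.1 * riem bF gF α β γ δ z.2
        - pderiv bE a (fun u => 1 / 2 * (f u ^ 2 * warpP bE gB f u)) z.1
          * kn (gF z.2) (gF z.2) α β γ δ := by
    rw [pderiv_congr _ (h.riem_ffff_eventuallyEq bE bF hz α β γ δ),
      pderiv_sub _ (h.differentiableAt_riem_ffff_left bF hz α β γ δ)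
        (h.differentiableAt_riem_ffff_right bE hz α β γ δ),
      pderiv_inl_mul bE bF (φ := f) (ψ := riem bF gF α β γ δ) (h.f_diff hz.1)
        (h.fiber.diff (h.fiber.smooth_riem bF _ _ _ _) hz.2),
      pderiv_inl_mul bE bF (φ := fun u => 1 / 2 * (f u ^ 2 * warpP bE gB f u))
        (ψ := fun w => kn (gF w) (gF w) α β γ δ) (h.base.diff (h.smooth_normSq bE) hz.1)
        (h.fiber.diff (h.fiber.smooth_kn _ _ _ _) hz.2)]
  simp only [covRiem, hp, Fintype.sum_sum_type,
    h.christoffel_bbf bE bF hz, h.christoffel_fbf bE bF hz, h.riem_ffff bE bF hz,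
    zero_mul, Finset.sum_const_zero, zero_add, Matrix.one_apply, mul_ite, mul_one,
    mul_zero, ite_mul, Finset.sum_add_distrib, Finset.sum_ite_eq', Finset.mem_univ, if_true]
  field_simp
  ring

/-- The differentiated component vanishes identically, so only Christoffel terms survive: $a$ turns
into a fiber index, which gives the curvature itself, and $\gamma$ or $\delta$ turns into a base
index, which gives $T$. -/
theorem covRiem_bfff_f (a : ι) (β γ δ ε : κ) :
    covRiem (bE.prod bF) (warpedMat gB gF f) (Sum.inl a) (Sum.inr β) (Sum.inr γ) (Sum.inr δ)
      (Sum.inr ε) z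
      = -(pderiv bE a f z.1 / (2 * f z.1))
          * riem (bE.prod bF) (warpedMat gB gF f) (Sum.inr ε) (Sum.inr β) (Sum.inr γ) (Sum.inr δ) z
        - 1 / 4 * f z.1 * (∑ b, gradComp bE gB f b z.1 * warpT bE gB f z.1 a b)
          * kn (gF z.2) (gF z.2) ε β γ δ := by
  have hp : pderiv (bE.prod bF) (Sum.inr ε) (riem (bE.prod bF) (warpedMat gB gF f)
      (Sum.inl a) (Sum.inr β) (Sum.inr γ) (Sum.inr δ)) z = 0 :=
    pderiv_of_eqOn_zero bE bF h.base.isOpen h.fiber.isOpen hz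
      (fun w hw => h.riem_bfff bE bF hw a β γ δ) _
  simp only [covRiem, hp, Fintype.sum_sum_type,
    h.christoffel_bfb bE bF hz, h.christoffel_ffb bE bF hz, h.christoffel_bff bE bF hz,
    h.riem_bbff bE bF hz, h.riem_bfff bE bF hz, h.riem_bfbf bE bF hz, h.riem_bffb bE bF hz,
    zero_mul, add_zero, zero_add, Matrix.one_apply, mul_ite, mul_one,
    mul_zero, ite_mul, Finset.sum_ite_eq', Finset.mem_univ, if_true, Finset.mul_sum,
    Finset.sum_mul]
  have e : ∑ b, (-(1 / 2) * gradComp bE gB f b z.1 * gF z.2 ε γ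
        * (f z.1 * warpT bE gB f z.1 a b * gF z.2 β δ)
      + -(1 / 2) * gradComp bE gB f b z.1 * gF z.2 ε δ
        * -(f z.1 * warpT bE gB f z.1 a b * gF z.2 β γ))
      = ∑ b, 1 / 4 * f z.1 * (gradComp bE gB f b z.1 * warpT bE gB f z.1 a b)
          * kn (gF z.2) (gF z.2) ε β γ δ := by
    refine Finset.sum_congr rfl fun b _ => ?_
    simp only [kn]
    ring
  rw [e]
  ring

/-- For the Einstein condition only proportionality to $\widetilde g$ matters, not the factor. -/
theorem exists_covRiem_bfbf_b (a b e : ι) : ∃ c : ℝ, ∀ β δ,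
    covRiem (bE.prod bF) (warpedMat gB gF f) (Sum.inl a) (Sum.inr β) (Sum.inl b) (Sum.inr δ)
      (Sum.inl e) z = c * gF z.2 β δ := by
  have hsm : ContDiffOn ℝ ∞ (fun u => f u * warpT bE gB f u a b) U :=
    h.smooth.mul (h.base.smooth_warpT bE h.smooth h.ne_zero a b)
  refine ⟨pderiv bE e (fun u => f u * warpT bE gB f u a b) z.1
    - ∑ s, (christoffel bE gB s e a z.1 * (f z.1 * warpT bE gB f z.1 s b)
      + christoffel bE gB s e b z.1 * (f z.1 * warpT bE gB f z.1 a s))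
    - 2 * (pderiv bE e f z.1 / (2 * f z.1)) * (f z.1 * warpT bE gB f z.1 a b), fun β δ => ?_⟩
  have hp : pderiv (bE.prod bF) (Sum.inl e) (riem (bE.prod bF) (warpedMat gB gF f)
      (Sum.inl a) (Sum.inr β) (Sum.inl b) (Sum.inr δ)) z
      = pderiv bE e (fun u => f u * warpT bE gB f u a b) z.1 * gF z.2 β δ :=
    pderiv_inl_of_eqOn bE bF h.base.isOpen h.fiber.isOpen hz
      (φ := fun u => f u * warpT bE gB f u a b) (ψ := fun w => gF w β δ)
      (fun w hw => h.riem_bfbf bE bF hw a b β δ) hsm (h.fiber.smooth β δ) e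
  simp only [covRiem, hp, Fintype.sum_sum_type,
    h.christoffel_bbb bE bF hz, h.christoffel_fbb bE bF hz, h.christoffel_bbf bE bF hz,
    h.christoffel_fbf bE bF hz, h.riem_bfbf bE bF hz,
    zero_mul, add_zero, Matrix.one_apply, mul_ite, mul_one, mul_zero, ite_mul, Finset.sum_ite_eq',
    Finset.mem_univ, if_true, Finset.sum_add_distrib, Finset.sum_const_zero]
  have e1 : ∀ φ ψ : ι → ℝ, ∑ s, φ s * (f z.1 * ψ s * gF z.2 β δ)
      = (∑ s, φ s * (f z.1 * ψ s)) * gF z.2 β δ := fun φ ψ => by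
    rw [Finset.sum_mul]
    exact Finset.sum_congr rfl fun s _ => by ring
  rw [e1, e1]
  ring

/-- Along the fiber the factor $fT_{ab}$ is constant and $\widetilde g$ is parallel; the terms that
change the type of an index meet vanishing components of $R$. -/
theorem covRiem_bfbf_f (a b : ι) (β δ ε : κ) :
    covRiem (bE.prod bF) (warpedMat gB gF f) (Sum.inl a) (Sum.inr β) (Sum.inl b) (Sum.inr δ)
      (Sum.inr ε) z = 0 := by
  have hp : pderiv (bE.prod bF) (Sum.inr ε) (riem (bE.prod bF) (warpedMat gB gF f)
      (Sum.inl a) (Sum.inr β) (Sum.inl b) (Sum.inr δ)) z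
      = f z.1 * warpT bE gB f z.1 a b * pderiv bF ε (fun w => gF w β δ) z.2 :=
    pderiv_inr_of_eqOn bE bF h.base.isOpen h.fiber.isOpen hz
      (φ := fun u => f u * warpT bE gB f u a b) (ψ := fun w => gF w β δ)
      (fun w hw => h.riem_bfbf bE bF hw a b β δ)
      (h.smooth.mul (h.base.smooth_warpT bE h.smooth h.ne_zero a b)) (h.fiber.smooth β δ) ε
  simp only [covRiem, hp, Fintype.sum_sum_type, h.fiber.pderiv_metric bF hz.2,
    h.christoffel_bfb bE bF hz, h.christoffel_ffb bE bF hz, h.christoffel_bff bE bF hz,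
    h.christoffel_fff bE bF hz, h.riem_bbbf bE bF hz, h.riem_bfbb bE bF hz,
    h.riem_ffbf bE bF hz, h.riem_bfff bE bF hz, h.riem_bfbf bE bF hz,
    zero_mul, add_zero, zero_add, mul_zero, Finset.sum_const_zero, Finset.mul_sum]
  rw [sub_eq_zero]
  exact Finset.sum_congr rfl fun s _ => by ring

end

end WarpData

end Warped

end LocalGeom

/-! ### Pointwise algebra of curvature identities. -/

namespace LocalGeom

section Pointwise

variable {E : Type*} [NormedAddCommGroup E] [NormedSpace ℝ E]
variable {ι : Type*} [Fintype ι] [DecidableEq ι] (b : Module.Basis ι ℝ E)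
variable {G : E → Matrix ι ι ℝ} {U : Set E} {u : E}

/-- The identity `∇R = π ⊗ R + ψ ⊗ (g ∧ S)` at a point, in coordinates. -/
def HyperAt (G : E → Matrix ι ι ℝ) (π ψ : ι → ℝ) (u : E) : Prop :=
  ∀ i j k l m, covRiem b G i j k l m u
    = π m * riem b G i j k l u + ψ m * kn (G u) (ricci b G u) i j k l

namespace SmoothMetricOn

theorem contract_riem (h : SmoothMetricOn G U) (hu : u ∈ U) (j k : ι) :
    ricci b G u j k = ∑ i, riemUp b G i i j k u := by
  simp only [ricci, Matrix.of_apply, riem, Finset.mul_sum]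
  refine Finset.sum_congr rfl fun i _ => ?_
  rw [Finset.sum_comm]
  calc _ = ∑ s, ((G u)⁻¹ * G u) i s * riemUp b G s i j k u := by
        refine Finset.sum_congr rfl fun s _ => ?_
        rw [Matrix.mul_apply, Finset.sum_mul]
        exact Finset.sum_congr rfl fun l _ => by ring
    _ = _ := by simp [h.inv_mul hu, Matrix.one_apply]

/-- With only the indices $i\neq j$, antisymmetry in the first pair leaves one term in each Ricci
sum, so every $R^s{}_{ijk}$ is a Ricci component up to sign. This covers the dimensions in which the
factor $n-2$ below cannot be cancelled. -/
theorem riem_eq_zero_of_ricci_eq_zero (h : SmoothMetricOn G U) (hu : u ∈ U)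
    (hcard : Fintype.card ι ≤ 2) (hS : ricci b G u = 0) (i j k l : ι) : riem b G i j k l u = 0 := by
  by_cases hij : i = j
  · have := riem_antisymm b G i j k l u
    subst hij
    linarith
  have hall : ∀ s, s = i ∨ s = j := by
    intro s
    by_contra! hs
    have := Finset.card_le_univ ({s, i, j} : Finset ι)
    rw [Finset.card_insert_of_notMem (by simp [hs.1, hs.2]), Finset.card_pair hij] at this
    omega
  have huniv : (Finset.univ : Finset ι) = {i, j} := by
    ext s
    simpa using hall s
  have anti : ∀ s i j k, riemUp b G s i j k u = -riemUp b G s j i k u := by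
    intro s i j k
    simp only [riemUp, Finset.sum_sub_distrib]
    ring
  have h1 := h.contract_riem b hu j k
  have h2 := h.contract_riem b hu i k
  rw [hS, huniv, Finset.sum_pair hij, Matrix.zero_apply] at h1 h2
  have h3 := anti j j j k
  have h4 := anti i i i k
  have h5 := anti j i j k
  refine Finset.sum_eq_zero fun s _ => mul_eq_zero_of_right _ ?_
  rcases hall s with rfl | rfl <;> linarith

/-- If `∇R = π ⊗ R + ψ ⊗ (g ∧ T)` at a point and the Ricci tensor vanishes identically, then
`∇R = π ⊗ R` at that point. -/
theorem recurrent_of_ricci_eq_zero (h : SmoothMetricOn G U) (hu : u ∈ U)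
    (hS : ∀ w ∈ U, ricci b G w = 0) {π ψ : ι → ℝ} {T : Matrix ι ι ℝ}
    (hH : ∀ i j k l m, covRiem b G i j k l m u = π m * riem b G i j k l u
      + ψ m * kn (G u) T i j k l) (i j k l m : ι) :
    covRiem b G i j k l m u = π m * riem b G i j k l u := by
  by_cases hcard : Fintype.card ι ≤ 2
  · have hR := fun w hw => h.riem_eq_zero_of_ricci_eq_zero b (u := w) hw hcard (hS w hw)
    have hp : pderiv b m (riem b G i j k l) u = 0 := by
      have : riem b G i j k l =ᶠ[nhds u] fun _ => 0 := by
        filter_upwards [h.isOpen.mem_nhds hu] with w hw using hR w hw i j k l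
      rw [pderiv_congr b this, pderiv_const]
    simp [covRiem, hp, hR u hu]
  -- Contracting the hypothesis: the trace of $\nabla R$ is $\nabla S$, which vanishes because $S=0$
  -- on a whole neighbourhood, and the trace of $R$ vanishes too.
  have key : ∀ j k, ψ m * (((Fintype.card ι : ℝ) - 2) * T j k
      + (∑ i, ∑ l, (G u)⁻¹ i l * T i l) * G u j k) = 0 := by
    intro j k
    have hz := h.contract_covRiem b hu j k m
    have hp : pderiv b m (fun w => ricci b G w j k) u = 0 := by
      have : (fun w => ricci b G w j k) =ᶠ[nhds u] fun _ => 0 := by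
        filter_upwards [h.isOpen.mem_nhds hu] with w hw
        rw [hS w hw]
        rfl
      rw [pderiv_congr b this, pderiv_const]
    have hr : ∑ i, ∑ l, (G u)⁻¹ i l * riem b G i j k l u = 0 :=
      congrFun (congrFun (hS u hu) j) k
    rw [← contract_kn (h.symm u hu) (h.det u hu)]
    simp only [hp, hS u hu, Matrix.zero_apply, mul_zero, add_zero, Finset.sum_const_zero,
      sub_zero, hH] at hz
    rw [← hz]
    simp only [mul_add, Finset.sum_add_distrib]
    have e : ∑ i, ∑ l, (G u)⁻¹ i l * (π m * riem b G i j k l u)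
        = π m * ∑ i, ∑ l, (G u)⁻¹ i l * riem b G i j k l u := by
      simp only [Finset.mul_sum]
      exact Finset.sum_congr rfl fun i _ => Finset.sum_congr rfl fun l _ => by ring
    rw [e, hr, mul_zero, zero_add, Finset.mul_sum]
    refine Finset.sum_congr rfl fun i _ => ?_
    rw [Finset.mul_sum]
    exact Finset.sum_congr rfl fun l _ => by ring
  rw [hH]
  by_cases hψ : ψ m = 0
  · rw [hψ, zero_mul, add_zero]
  replace key := fun j k => (mul_eq_zero.1 (key j k)).resolve_left hψ
  push Not at hcard
  have hc : (3 : ℝ) ≤ Fintype.card ι := by exact_mod_cast hcard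
  -- A second contraction gives $(2n-2)\operatorname{tr}T=0$; then $(n-2)T=0$, and $n\geq3$ yields
  -- $T=0$.
  have htr : ∑ i, ∑ l, (G u)⁻¹ i l * T i l = 0 := by
    set t := ∑ i, ∑ l, (G u)⁻¹ i l * T i l with ht
    have h0 : ∑ j, ∑ k, (G u)⁻¹ j k * (((Fintype.card ι : ℝ) - 2) * T j k + t * G u j k) = 0 :=
      Finset.sum_eq_zero fun j _ => Finset.sum_eq_zero fun k _ => by rw [key, mul_zero]
    have h1 : ∑ j, ∑ k, (G u)⁻¹ j k * (((Fintype.card ι : ℝ) - 2) * T j k + t * G u j k)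
        = ((Fintype.card ι : ℝ) - 2) * t + t * ∑ j, ∑ k, (G u)⁻¹ j k * G u j k := by
      rw [ht]
      simp only [Finset.mul_sum, ← Finset.sum_add_distrib]
      rw [← ht]
      exact Finset.sum_congr rfl fun i _ => Finset.sum_congr rfl fun l _ => by ring
    rw [h1, sum_inv_mul_self (h.symm u hu) (h.det u hu)] at h0
    have h2 : t * (2 * (Fintype.card ι : ℝ) - 2) = 0 := by linarith
    exact (mul_eq_zero.1 h2).resolve_right (by linarith)
  have hT : ∀ j k, T j k = 0 := by
    intro j k
    have := key j k
    rw [htr, zero_mul, add_zero] at this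
    exact (mul_eq_zero.1 this).resolve_left (by linarith)
  simp [kn, hT]

/-- A curvature tensor of the form `g ∧ A` at a point has vanishing conformal part there. -/
theorem weyl_eq_zero (h : SmoothMetricOn G U) (hu : u ∈ U) (hcard : 3 ≤ Fintype.card ι)
    {A : Matrix ι ι ℝ} (hR : ∀ i j k l, riem b G i j k l u = kn (G u) A i j k l) (i j k l : ι) :
    weyl b G i j k l u = 0 := by
  have hc : (3 : ℝ) ≤ Fintype.card ι := by exact_mod_cast hcard
  set t := ∑ i, ∑ l, (G u)⁻¹ i l * A i l with ht
  -- With $\kappa=2(n-1)t$ this determines $A=\frac1{n-2}S-\frac{\kappa}{2(n-1)(n-2)}g$, and then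
  -- $R=g\wedge A$ is exactly the vanishing of the conformal tensor.
  have hS : ∀ j k, ricci b G u j k = ((Fintype.card ι : ℝ) - 2) * A j k + t * G u j k := by
    intro j k
    simp only [ricci, Matrix.of_apply, hR]
    exact contract_kn (h.symm u hu) (h.det u hu) A j k
  have hk : scal b G u = 2 * ((Fintype.card ι : ℝ) - 1) * t := by
    have h1 : ∑ j, ∑ k, (G u)⁻¹ j k * (((Fintype.card ι : ℝ) - 2) * A j k + t * G u j k)
        = ((Fintype.card ι : ℝ) - 2) * t + t * ∑ j, ∑ k, (G u)⁻¹ j k * G u j k := by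
      rw [ht]
      simp only [Finset.mul_sum, ← Finset.sum_add_distrib]
      rw [← ht]
      exact Finset.sum_congr rfl fun i _ => Finset.sum_congr rfl fun l _ => by ring
    simp only [scal, hS, h1, sum_inv_mul_self (h.symm u hu) (h.det u hu)]
    ring
  have h1 : (Fintype.card ι : ℝ) - 1 ≠ 0 := by linarith
  have h2 : (Fintype.card ι : ℝ) - 2 ≠ 0 := by linarith
  simp only [weyl, hR, hk, kn, hS]
  field_simp
  ring

theorem einstein_of_ricci_eq_smul (h : SmoothMetricOn G U) (hu : u ∈ U) {c : ℝ}
    (hS : ∀ j k, ricci b G u j k = c * G u j k) :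
    ricci b G u = (scal b G u / (Fintype.card ι : ℝ)) • G u := by
  rcases isEmpty_or_nonempty ι with hι | hι
  · exact Subsingleton.elim _ _
  have hk : scal b G u = c * Fintype.card ι := by
    rw [← sum_inv_mul_self (h.symm u hu) (h.det u hu)]
    simp only [scal, hS, Finset.mul_sum]
    exact Finset.sum_congr rfl fun i _ => Finset.sum_congr rfl fun l _ => by ring
  have hn : (Fintype.card ι : ℝ) ≠ 0 := by simp
  ext j k
  rw [hS, hk, mul_div_assoc, div_self hn, mul_one]
  rfl

theorem exists_ne_zero (h : SmoothMetricOn G U) (hu : u ∈ U) [Nonempty ι] :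
    ∃ i j, G u i j ≠ 0 := by
  by_contra! h0
  have : G u = 0 := Matrix.ext h0
  have hd := (h.det u hu).ne_zero
  rw [this, Matrix.det_zero] at hd
  exact hd rfl

end SmoothMetricOn

end Pointwise

/-! ### The identity (H) read block by block. -/

section Warped

variable {E F : Type*} [NormedAddCommGroup E] [NormedSpace ℝ E]
  [NormedAddCommGroup F] [NormedSpace ℝ F]
variable {ι κ : Type*} (bE : Module.Basis ι ℝ E) (bF : Module.Basis κ ℝ F)
variable {gB : E → Matrix ι ι ℝ} {gF : F → Matrix κ κ ℝ} {f : E → ℝ} {U : Set E} {V : Set F}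
  {z : E × F}
variable [Fintype ι] [DecidableEq ι] [Fintype κ] [DecidableEq κ]
variable {π ψ : ι ⊕ κ → ℝ}

namespace WarpData

section Hyper

variable (h : WarpData gB gF f U V) (hz : z ∈ U ×ˢ V)
  (hH : HyperAt (bE.prod bF) (warpedMat gB gF f) π ψ z)
include h hz hH

theorem base_identity (a b c d e : ι) :
    covRiem bE gB a b c d e z.1 = π (Sum.inl e) * riem bE gB a b c d z.1
      + ψ (Sum.inl e) * kn (gB z.1)
        (ricci bE gB z.1 - (Fintype.card κ : ℝ) • warpT bE gB f z.1) a b c d := by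
  have e1 := hH (Sum.inl a) (Sum.inl b) (Sum.inl c) (Sum.inl d) (Sum.inl e)
  rw [h.covRiem_bbbb_b bE bF hz, h.riem_bbbb bE bF hz] at e1
  rw [e1]
  simp only [kn, warpedMat_bb, h.ricci_bb bE bF hz, Matrix.sub_apply, Matrix.smul_apply,
    smul_eq_mul]

theorem fiber_identity (α β γ δ ε : κ) :
    covRiem bF gF α β γ δ ε z.2 = π (Sum.inr ε) * riem bF gF α β γ δ z.2
      + ψ (Sum.inr ε) * kn (gF z.2) (ricci bF gF z.2) α β γ δ
      + (-(1 / 2) * f z.1 * warpP bE gB f z.1 * π (Sum.inr ε)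
        + warpQ bE gB f (Fintype.card κ) z.1 * ψ (Sum.inr ε)) * kn (gF z.2) (gF z.2) α β γ δ := by
  have h0 := h.ne_zero _ hz.1
  have e1 := hH (Sum.inr α) (Sum.inr β) (Sum.inr γ) (Sum.inr δ) (Sum.inr ε)
  rw [h.covRiem_ffff_f bE bF hz, h.riem_ffff bE bF hz] at e1
  apply mul_left_cancel₀ h0
  rw [e1]
  simp only [kn, warpedMat_ff, h.ricci_ff bE bF hz]
  ring

/-- In the base derivative of the fiber block, $\widetilde R$ has coefficient $-f_a$ on the left and
$f\Pi_a$ on the right; everything else is $\widetilde g\wedge$ a 2-tensor, and $A$ is the result of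
solving for $\widetilde R$. -/
theorem exists_riem_eq_kn {a : ι} (ha : pderiv bE a f z.1 + f z.1 * π (Sum.inl a) ≠ 0) :
    ∃ A : Matrix κ κ ℝ, ∀ α β γ δ, riem bF gF α β γ δ z.2 = kn (gF z.2) A α β γ δ := by
  obtain ⟨c, hc⟩ := h.exists_covRiem_ffff_b bE bF hz a
  refine ⟨Matrix.of fun α β => (pderiv bE a f z.1 + f z.1 * π (Sum.inl a))⁻¹
    * ((c + 1 / 2 * (f z.1 ^ 2 * warpP bE gB f z.1) * π (Sum.inl a)) * gF z.2 α β
      - ψ (Sum.inl a) * f z.1 * (ricci bF gF z.2 α β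
        + warpQ bE gB f (Fintype.card κ) z.1 * gF z.2 α β)), fun α β γ δ => ?_⟩
  have e1 := hH (Sum.inr α) (Sum.inr β) (Sum.inr γ) (Sum.inr δ) (Sum.inl a)
  rw [hc, h.riem_ffff bE bF hz] at e1
  simp only [kn, warpedMat_ff, h.ricci_ff bE bF hz, Matrix.of_apply] at e1 ⊢
  apply mul_left_cancel₀ ha
  field_simp
  linarith

theorem exists_ricci_eq_smul [Nonempty ι] {m : ι ⊕ κ} (hm : ψ m ≠ 0) :
    ∃ c : ℝ, ∀ β δ, ricci bF gF z.2 β δ = c * gF z.2 β δ := by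
  -- In $(g\wedge S)_{a\beta b\delta}=-(\overline g_{ab}S_{\beta\delta}+S_{ab}f\widetilde
  -- g_{\beta\delta})$ the entry $\overline g_{ab}$ must be nonzero to isolate $S_{\beta\delta}$.
  obtain ⟨a, b, hab⟩ := h.base.exists_ne_zero hz.1
  obtain ⟨c, hc⟩ : ∃ c : ℝ, ∀ β δ, covRiem (bE.prod bF) (warpedMat gB gF f)
      (Sum.inl a) (Sum.inr β) (Sum.inl b) (Sum.inr δ) m z = c * gF z.2 β δ := by
    rcases m with e | ε
    · exact h.exists_covRiem_bfbf_b bE bF hz a b e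
    · exact ⟨0, fun β δ => by rw [h.covRiem_bfbf_f bE bF hz, zero_mul]⟩
  refine ⟨(π m * f z.1 * warpT bE gB f z.1 a b - c - ψ m * f z.1
    * (ricci bE gB z.1 a b - Fintype.card κ * warpT bE gB f z.1 a b)) / (ψ m * gB z.1 a b)
    - warpQ bE gB f (Fintype.card κ) z.1, fun β δ => ?_⟩
  have e1 := hH (Sum.inl a) (Sum.inr β) (Sum.inl b) (Sum.inr δ) m
  rw [hc, h.riem_bfbf bE bF hz] at e1
  simp only [kn, warpedMat_bf, warpedMat_fb, warpedMat_bb, warpedMat_ff, h.ricci_ff bE bF hz,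
    h.ricci_bb bE bF hz, h.ricci_bf bE bF hz, h.ricci_fb bE bF hz] at e1
  field_simp
  linarith

theorem riem_eq_const_mul_kn {a : ι} (ha : pderiv bE a f z.1 ≠ 0) (α β γ δ : κ) :
    riem bF gF α β γ δ z.2 = (f z.1 * warpP bE gB f z.1 - f z.1
      * (∑ b, gradComp bE gB f b z.1 * warpT bE gB f z.1 a b) / pderiv bE a f z.1) / 2
        * kn (gF z.2) (gF z.2) α β γ δ := by
  have h0 := h.ne_zero _ hz.1
  -- Differentiation is along $\alpha$, so that the term arising from the slot $a$ is
  -- $R_{\alpha\beta\gamma\delta}$. The right-hand side vanishes, hence neither $\pi$ nor $\psi$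
  -- occurs in the resulting constant.
  have e1 := hH (Sum.inl a) (Sum.inr β) (Sum.inr γ) (Sum.inr δ) (Sum.inr α)
  rw [h.covRiem_bfff_f bE bF hz, h.riem_bfff bE bF hz, h.riem_ffff bE bF hz] at e1
  have e2 : kn (warpedMat gB gF f z) (ricci (bE.prod bF) (warpedMat gB gF f) z)
      (Sum.inl a) (Sum.inr β) (Sum.inr γ) (Sum.inr δ) = 0 := by
    simp [kn, warpedMat_bf, h.ricci_bf bE bF hz]
  rw [e2] at e1
  field_simp at e1 ⊢
  linarith

end Hyper

/-- If the curvature tensor of a warped product is recurrent at a point, so is that of the fiber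
at the projected point. -/
theorem exists_recurrent_fiber [Nonempty κ] (h : WarpData gB gF f U V) (hz : z ∈ U ×ˢ V)
    (hH : HyperAt (bE.prod bF) (warpedMat gB gF f) π 0 z) :
    ∃ ξ : κ → ℝ, ∀ α β γ δ ε, covRiem bF gF α β γ δ ε z.2 = ξ ε * riem bF gF α β γ δ z.2 := by
  have h0 := h.ne_zero _ hz.1
  by_cases hd : ∃ a, pderiv bE a f z.1 ≠ 0
  · obtain ⟨a, ha⟩ := hd
    obtain ⟨β₀, δ₀, hg⟩ := h.fiber.exists_ne_zero hz.2
    -- $R_{a\beta b\delta}$ is parallel along the fiber, so recurrence gives $\pi_\varepsilon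
    -- T_{ab}=0$. After multiplication by $\pi_\varepsilon$ the $T$-part of the constant curvature
    -- drops out, so $\pi_\varepsilon\widetilde R=\tfrac12fP\,\pi_\varepsilon\,\widetilde
    -- g\wedge\widetilde g$, which cancels the extra term of the fiber identity:
    -- $\widetilde\nabla\widetilde R=0$.
    have hT : ∀ ε b, π (Sum.inr ε) * warpT bE gB f z.1 a b = 0 := by
      intro ε b
      have e1 := hH (Sum.inl a) (Sum.inr β₀) (Sum.inl b) (Sum.inr δ₀) (Sum.inr ε)
      rw [h.covRiem_bfbf_f bE bF hz, h.riem_bfbf bE bF hz] at e1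
      have e2 : f z.1 * gF z.2 β₀ δ₀ * (π (Sum.inr ε) * warpT bE gB f z.1 a b) = 0 := by
        simp only [Pi.zero_apply, zero_mul, add_zero] at e1
        linarith
      exact (mul_eq_zero.1 e2).resolve_left (mul_ne_zero h0 hg)
    refine ⟨0, fun α β γ δ ε => ?_⟩
    have e1 := h.fiber_identity bE bF hz hH α β γ δ ε
    have e2 := h.riem_eq_const_mul_kn bE bF hz hH ha α β γ δ
    have e3 : π (Sum.inr ε) * ∑ b, gradComp bE gB f b z.1 * warpT bE gB f z.1 a b = 0 := by
      rw [Finset.mul_sum]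
      exact Finset.sum_eq_zero fun b _ => by rw [mul_left_comm, hT, mul_zero]
    rw [e1, e2]
    simp only [Pi.zero_apply, zero_mul, mul_zero, add_zero]
    linear_combination (-(1 / 2) * f z.1 / pderiv bE a f z.1 * kn (gF z.2) (gF z.2) α β γ δ) * e3
  -- If $df=0$ at the point, then $P=0$ and the fiber identity is already a recurrence.
  · push Not at hd
    refine ⟨fun ε => π (Sum.inr ε), fun α β γ δ ε => ?_⟩
    have hP : warpP bE gB f z.1 = 0 := by simp [warpP, hd]
    simpa [hP] using h.fiber_identity bE bF hz hH α β γ δ ε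

end WarpData

end Warped

end LocalGeom

/-! ### Charts, product charts and components of fields. -/

namespace SemiRiem

open LocalGeom

section Chart

variable {E : Type*} [NormedAddCommGroup E] [NormedSpace ℝ E]
variable {H : Type*} [TopologicalSpace H] {I : ModelWithCorners ℝ E H} [I.Boundaryless]
variable {M : Type*} [TopologicalSpace M] [ChartedSpace H M] [IsManifold I ∞ M]
variable {ι : Type*} (b : Module.Basis ι ℝ E)

theorem mdifferentiableAt_chart_symm {x₀ : M} {u : E} (hu : u ∈ (extChartAt I x₀).target) :
    MDifferentiableAt 𝓘(ℝ, E) I (extChartAt I x₀).symm u :=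
  ((contMDiffOn_extChartAt_symm (n := ∞) x₀).contMDiffAt
    ((isOpen_extChartAt_target x₀).mem_nhds hu)).mdifferentiableAt (by simp)

theorem surjective_mfderiv_chart_symm {x₀ : M} {u : E} (hu : u ∈ (extChartAt I x₀).target) :
    Function.Surjective (mfderiv 𝓘(ℝ, E) I (extChartAt I x₀).symm u) := by
  have : IsManifold I 1 M := IsManifold.of_le (n := ∞) (by simp)
  have h := isInvertible_mfderivWithin_extChartAt_symm (I := I) hu
  rw [I.range_eq_univ, mfderivWithin_univ] at h
  exact h.bijective.2

theorem linearMap_eq_zero_of_coordVec {V : Type*} [AddCommGroup V] [Module ℝ V] {x₀ : M} {u : E}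
    (hu : u ∈ (extChartAt I x₀).target)
    (L : TangentSpace I ((extChartAt I x₀).symm u) →ₗ[ℝ] V)
    (hL : ∀ i, L (coordVec (I := I) b x₀ i u) = 0) : L = 0 := by
  have h : L.comp (mfderiv 𝓘(ℝ, E) I (extChartAt I x₀).symm u).toLinearMap = 0 :=
    b.ext fun i => hL i
  ext v
  obtain ⟨w, rfl⟩ := surjective_mfderiv_chart_symm hu v
  exact LinearMap.congr_fun h w

theorem exists_comps₁_ne_zero (P : CovectorField I M) {x : M} (hP : P x ≠ 0) :
    ∃ i, comps₁ b P x i (extChartAt I x x) ≠ 0 := by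
  by_contra! h
  have h1 := linearMap_eq_zero_of_coordVec b (mem_extChartAt_target (I := I) x)
    (P ((extChartAt I x).symm (extChartAt I x x))).toLinearMap h
  -- The chart returns $x$ only up to a propositional equality, so the covector has to be
  -- transported between fibers.
  have key : ∀ y, y = x → (P y : E →L[ℝ] ℝ).toLinearMap = 0 → P x = 0 := by
    rintro y rfl hy
    exact ContinuousLinearMap.coe_injective hy
  exact hP (key _ (extChartAt_to_inv x) h1)

omit [I.Boundaryless] in
theorem contDiffOn_comp_chart_symm {f : M → ℝ} (hf : ContMDiff I 𝓘(ℝ, ℝ) ∞ f) (x₀ : M) :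
    ContDiffOn ℝ ∞ (f ∘ (extChartAt I x₀).symm) (extChartAt I x₀).target :=
  (hf.comp_contMDiffOn (contMDiffOn_extChartAt_symm x₀)).contDiffOn

theorem comps₁_differential {f : M → ℝ} (hf : ContMDiff I 𝓘(ℝ, ℝ) ∞ f) {x₀ : M} {u : E}
    (hu : u ∈ (extChartAt I x₀).target) (i : ι) :
    comps₁ b (differential I f) x₀ i u = pderiv b i (f ∘ (extChartAt I x₀).symm) u := by
  have h := mfderiv_comp (I := 𝓘(ℝ, E)) (I' := I) (I'' := 𝓘(ℝ, ℝ)) u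
    (hf.mdifferentiable (by simp) _) (mdifferentiableAt_chart_symm (I := I) hu)
  rw [mfderiv_eq_fderiv] at h
  simp only [pderiv, comps₁, differential, coordVec]
  rw [h]
  rfl

variable [Fintype ι] [DecidableEq ι]

theorem IsMetric.smoothMetricOn {g : BilinField I M} (hg : IsMetric b g) (x₀ : M) :
    SmoothMetricOn (comps b g x₀) (extChartAt I x₀).target where
  isOpen := isOpen_extChartAt_target x₀
  symm u _ := by
    ext i j
    exact hg.symm _ _ _
  smooth i j := hg.smooth x₀ i j
  det u hu := by
    rw [isUnit_iff_ne_zero]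
    intro h0
    -- A kernel vector of the Gram matrix gives a tangent vector orthogonal to all coordinate
    -- vectors, hence to everything; nondegeneracy and injectivity of the chart derivative make its
    -- coefficients zero.
    obtain ⟨c, hc0, hc⟩ := Matrix.exists_mulVec_eq_zero_iff.2 h0
    set D : E →ₗ[ℝ] TangentSpace I ((extChartAt I x₀).symm u) :=
      (mfderiv 𝓘(ℝ, E) I (extChartAt I x₀).symm u).toLinearMap with hD
    have hv : ∀ i, coordVec (I := I) b x₀ i u = D (b i) := fun i => rfl
    have h1 : D (∑ j, c j • b j) = 0 := by
      refine hg.nondeg _ _ fun w => ?_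
      have h2 : g ((extChartAt I x₀).symm u) (D (∑ j, c j • b j)) = 0 := by
        refine linearMap_eq_zero_of_coordVec b hu _ fun i => ?_
        have h3 := congrFun hc i
        rw [hg.symm]
        simp only [Matrix.mulVec, dotProduct, comps, Matrix.of_apply, Pi.zero_apply, hv] at h3
        simp only [map_sum, map_smul, hv, smul_eq_mul]
        rw [← h3]
        exact Finset.sum_congr rfl fun j _ => mul_comm _ _
      rw [h2]
      rfl
    have hinj : Function.Injective D := by
      have : FiniteDimensional ℝ E := b.finiteDimensional_of_finite
      exact LinearMap.injective_iff_surjective.2 (surjective_mfderiv_chart_symm hu)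
    have h4 : ∑ j, c j • b j = 0 := hinj (by rw [h1, map_zero])
    exact hc0 (funext fun i => Fintype.linearIndependent_iff.1 b.linearIndependent c h4 i)

end Chart

section Product

variable {E F : Type*} [NormedAddCommGroup E] [NormedSpace ℝ E]
  [NormedAddCommGroup F] [NormedSpace ℝ F]
variable {H K : Type*} [TopologicalSpace H] [TopologicalSpace K]
variable {I : ModelWithCorners ℝ E H} {J : ModelWithCorners ℝ F K}
  [I.Boundaryless] [J.Boundaryless]
variable {M N : Type*} [TopologicalSpace M] [ChartedSpace H M]
  [TopologicalSpace N] [ChartedSpace K N] [IsManifold I ∞ M] [IsManifold J ∞ N]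
variable {ι κ : Type*} (bE : Module.Basis ι ℝ E) (bF : Module.Basis κ ℝ F)

omit [I.Boundaryless] [J.Boundaryless] [IsManifold I ∞ M] [IsManifold J ∞ N] in
theorem chart_prod_symm (z₀ : M × N) (w : E × F) : (extChartAt (I.prod J) z₀).symm w
    = ((extChartAt I z₀.1).symm w.1, (extChartAt J z₀.2).symm w.2) := by
  rw [extChartAt_prod]
  rfl

theorem mfderiv_chart_prod_symm {z₀ : M × N} {w : E × F} (h1 : w.1 ∈ (extChartAt I z₀.1).target)
    (h2 : w.2 ∈ (extChartAt J z₀.2).target) (v : E × F) :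
    (mfderiv 𝓘(ℝ, E × F) (I.prod J) (extChartAt (I.prod J) z₀).symm w v : E × F)
      = ((mfderiv 𝓘(ℝ, E) I (extChartAt I z₀.1).symm w.1 v.1 : E),
        (mfderiv 𝓘(ℝ, F) J (extChartAt J z₀.2).symm w.2 v.2 : F)) := by
  have e : ((extChartAt (I.prod J) z₀).symm : E × F → M × N)
      = fun w => ((extChartAt I z₀.1).symm w.1, (extChartAt J z₀.2).symm w.2) :=
    funext fun w => chart_prod_symm z₀ w
  have d1 := (mdifferentiableAt_chart_symm h1).hasMFDerivAt.comp w
    (hasFDerivAt_fst (𝕜 := ℝ) (p := w)).hasMFDerivAt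
  have d2 := (mdifferentiableAt_chart_symm h2).hasMFDerivAt.comp w
    (hasFDerivAt_snd (𝕜 := ℝ) (p := w)).hasMFDerivAt
  have d3 := d1.prodMk d2
  have d4 : HasMFDerivAt 𝓘(ℝ, E × F) (I.prod J) (extChartAt (I.prod J) z₀).symm w
      ((((mfderiv 𝓘(ℝ, E) I (extChartAt I z₀.1).symm w.1 : E →L[ℝ] E).comp
        (ContinuousLinearMap.fst ℝ E F)).prod
        ((mfderiv 𝓘(ℝ, F) J (extChartAt J z₀.2).symm w.2 : F →L[ℝ] F).comp
          (ContinuousLinearMap.snd ℝ E F)) : E × F →L[ℝ] E × F)) := by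
    rw [e]
    exact d3
  rw [d4.mfderiv]
  rfl

theorem coordVec_prod_inl {z₀ : M × N} {w : E × F} (h1 : w.1 ∈ (extChartAt I z₀.1).target)
    (h2 : w.2 ∈ (extChartAt J z₀.2).target) (a : ι) :
    (coordVec (I := I.prod J) (bE.prod bF) z₀ (Sum.inl a) w : E × F)
      = ((coordVec (I := I) bE z₀.1 a w.1 : E), (0 : F)) := by
  refine (mfderiv_chart_prod_symm h1 h2 _).trans ?_
  rw [Module.Basis.prod_apply_inl_fst, Module.Basis.prod_apply_inl_snd]
  exact Prod.ext rfl (ContinuousLinearMap.map_zero _)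

theorem coordVec_prod_inr {z₀ : M × N} {w : E × F} (h1 : w.1 ∈ (extChartAt I z₀.1).target)
    (h2 : w.2 ∈ (extChartAt J z₀.2).target) (α : κ) :
    (coordVec (I := I.prod J) (bE.prod bF) z₀ (Sum.inr α) w : E × F)
      = ((0 : E), (coordVec (I := J) bF z₀.2 α w.2 : F)) := by
  refine (mfderiv_chart_prod_symm h1 h2 _).trans ?_
  rw [Module.Basis.prod_apply_inr_fst, Module.Basis.prod_apply_inr_snd]
  exact Prod.ext (ContinuousLinearMap.map_zero _) rfl

omit [I.Boundaryless] [J.Boundaryless] [IsManifold I ∞ M] [IsManifold J ∞ N] in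
theorem warped_apply (gB : BilinField I M) (gF : BilinField J N) (f : M → ℝ) (z : M × N)
    (v w : E × F) :
    warped gB gF f z v w = (gB z.1 : LinearMap.BilinForm ℝ E) v.1 w.1
      + f z.1 * (gF z.2 : LinearMap.BilinForm ℝ F) v.2 w.2 := by
  simp only [warped, mfderiv_fst, mfderiv_snd]
  rfl

theorem comps_warped (gB : BilinField I M) (gF : BilinField J N) (f : M → ℝ) {z₀ : M × N}
    {w : E × F} (h1 : w.1 ∈ (extChartAt I z₀.1).target)
    (h2 : w.2 ∈ (extChartAt J z₀.2).target) :
    comps (bE.prod bF) (warped gB gF f) z₀ w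
      = warpedMat (comps bE gB z₀.1) (comps bF gF z₀.2) (f ∘ (extChartAt I z₀.1).symm) w := by
  have key : ∀ p p' : M × N, p = p' → ∀ v v' : E × F,
      (warped gB gF f p : LinearMap.BilinForm ℝ (E × F)) v v'
        = (warped gB gF f p' : LinearMap.BilinForm ℝ (E × F)) v v' := by
    rintro p _ rfl v v'
    rfl
  -- The forms are fixed on the model spaces, so that coordinate vectors can be rewritten without
  -- dependence on the base point of the tangent space.
  obtain ⟨A, C, hAC, hA, hC⟩ : ∃ (A : LinearMap.BilinForm ℝ E) (C : LinearMap.BilinForm ℝ F),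
      (∀ i j, comps (bE.prod bF) (warped gB gF f) z₀ w i j
        = A (coordVec (I := I.prod J) (bE.prod bF) z₀ i w : E × F).1
            (coordVec (I := I.prod J) (bE.prod bF) z₀ j w : E × F).1
          + f ((extChartAt I z₀.1).symm w.1)
            * C (coordVec (I := I.prod J) (bE.prod bF) z₀ i w : E × F).2
              (coordVec (I := I.prod J) (bE.prod bF) z₀ j w : E × F).2)
      ∧ (∀ a c, A (coordVec (I := I) bE z₀.1 a w.1 : E) (coordVec (I := I) bE z₀.1 c w.1 : E)
        = comps bE gB z₀.1 w.1 a c)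
      ∧ ∀ α γ, C (coordVec (I := J) bF z₀.2 α w.2 : F) (coordVec (I := J) bF z₀.2 γ w.2 : F)
        = comps bF gF z₀.2 w.2 α γ :=
    ⟨gB ((extChartAt I z₀.1).symm w.1), gF ((extChartAt J z₀.2).symm w.2), fun i j =>
      (key _ _ (chart_prod_symm z₀ w) _ _).trans (warped_apply gB gF f _ _ _),
      fun _ _ => rfl, fun _ _ => rfl⟩
  ext i j
  rw [hAC]
  rcases i with a | α <;> rcases j with c | γ
  · rw [coordVec_prod_inl bE bF h1 h2, coordVec_prod_inl bE bF h1 h2, warpedMat_bb, hA, map_zero,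
      mul_zero, add_zero]
  · rw [coordVec_prod_inl bE bF h1 h2, coordVec_prod_inr bE bF h1 h2, warpedMat_bf, map_zero,
      map_zero, LinearMap.zero_apply, mul_zero, add_zero]
  · rw [coordVec_prod_inl bE bF h1 h2, coordVec_prod_inr bE bF h1 h2, warpedMat_fb, map_zero,
      map_zero, LinearMap.zero_apply, mul_zero, add_zero]
  · rw [coordVec_prod_inr bE bF h1 h2, coordVec_prod_inr bE bF h1 h2, warpedMat_ff, hC, map_zero,
      zero_add]
    rfl

theorem comps₁_basePart (P : CovectorField (I.prod J) (M × N)) (x₀ : M) (y : N) {u : E}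
    (hu : u ∈ (extChartAt I x₀).target) (a : ι) :
    comps₁ bE (basePart P y) x₀ a u
      = comps₁ (bE.prod bF) P (x₀, y) (Sum.inl a) (u, extChartAt J y y) := by
  have key : ∀ p p' : M × N, p = p' → ∀ v v' : E × F, v = v' →
      (P p : E × F →L[ℝ] ℝ) v = (P p' : E × F →L[ℝ] ℝ) v' := by
    rintro p _ rfl v _ rfl
    rfl
  unfold comps₁ basePart
  rw [mfderiv_prod_left]
  refine key _ _ ?_ _ _ ?_
  · rw [chart_prod_symm, extChartAt_to_inv]
  · rw [coordVec_prod_inl bE bF (z₀ := (x₀, y)) (w := (u, extChartAt J y y)) hu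
      (mem_extChartAt_target y)]
    rfl

theorem comps₁_fiberPart (P : CovectorField (I.prod J) (M × N)) (x : M) (y₀ : N) {v : F}
    (hv : v ∈ (extChartAt J y₀).target) (α : κ) :
    comps₁ bF (fiberPart P x) y₀ α v
      = comps₁ (bE.prod bF) P (x, y₀) (Sum.inr α) (extChartAt I x x, v) := by
  have key : ∀ p p' : M × N, p = p' → ∀ v v' : E × F, v = v' →
      (P p : E × F →L[ℝ] ℝ) v = (P p' : E × F →L[ℝ] ℝ) v' := by
    rintro p _ rfl v _ rfl
    rfl
  unfold comps₁ fiberPart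
  rw [mfderiv_prod_right]
  refine key _ _ ?_ _ _ ?_
  · rw [chart_prod_symm, extChartAt_to_inv]
  · rw [coordVec_prod_inr bE bF (z₀ := (x, y₀)) (w := (extChartAt I x x, v))
      (mem_extChartAt_target x) hv]
    rfl

theorem IsSmoothForm.basePart {P : CovectorField (I.prod J) (M × N)}
    (hP : IsSmoothForm (bE.prod bF) P) (y : N) : IsSmoothForm bE (basePart P y) := by
  intro x₀ a
  refine ((hP (x₀, y) (Sum.inl a)).comp (s := (extChartAt I x₀).target)
    (f := fun u : E => (u, extChartAt J y y)) (by fun_prop) ?_).congr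
    fun u hu => comps₁_basePart bE bF P x₀ y hu a
  intro u hu
  rw [extChartAt_prod]
  exact ⟨hu, mem_extChartAt_target y⟩

theorem IsSmoothForm.fiberPart {P : CovectorField (I.prod J) (M × N)}
    (hP : IsSmoothForm (bE.prod bF) P) (x : M) : IsSmoothForm bF (fiberPart P x) := by
  intro y₀ α
  refine ((hP (x, y₀) (Sum.inr α)).comp (s := (extChartAt J y₀).target)
    (f := fun v : F => (extChartAt I x x, v)) (by fun_prop) ?_).congr
    fun v hv => comps₁_fiberPart bE bF P x y₀ hv α
  intro v hv
  rw [extChartAt_prod]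
  exact ⟨mem_extChartAt_target x, hv⟩

end Product

end SemiRiem

/-! ### Consequences on the manifold. -/

namespace SemiRiem

open LocalGeom

section WarpedProduct

variable {E F : Type*} [NormedAddCommGroup E] [NormedSpace ℝ E]
  [NormedAddCommGroup F] [NormedSpace ℝ F]
variable {H K : Type*} [TopologicalSpace H] [TopologicalSpace K]
variable {I : ModelWithCorners ℝ E H} {J : ModelWithCorners ℝ F K}
  [I.Boundaryless] [J.Boundaryless]
variable {M N : Type*} [TopologicalSpace M] [ChartedSpace H M]
  [TopologicalSpace N] [ChartedSpace K N] [IsManifold I ∞ M] [IsManifold J ∞ N]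
variable {ι κ : Type*} {bE : Module.Basis ι ℝ E} {bF : Module.Basis κ ℝ F}
variable {gB : BilinField I M} {gF : BilinField J N} {f : M → ℝ}
variable {P Q : CovectorField (I.prod J) (M × N)}

/-- The components of a 1-form at the centre of the product chart around `(x, y)`. -/
noncomputable def centerComps (bE : Module.Basis ι ℝ E) (bF : Module.Basis κ ℝ F)
    (P : CovectorField (I.prod J) (M × N)) (x : M) (y : N) (m : ι ⊕ κ) : ℝ :=
  comps₁ (bE.prod bF) P (x, y) m (extChartAt I x x, extChartAt J y y)

/-- The warped product metric in the product chart around `(x, y)`. -/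
noncomputable def chartMat (bE : Module.Basis ι ℝ E) (bF : Module.Basis κ ℝ F)
    (gB : BilinField I M) (gF : BilinField J N) (f : M → ℝ) (x : M) (y : N) :
    E × F → Matrix (ι ⊕ κ) (ι ⊕ κ) ℝ :=
  warpedMat (comps bE gB x) (comps bF gF y) (f ∘ (extChartAt I x).symm)

omit [I.Boundaryless] [J.Boundaryless] [IsManifold I ∞ M] [IsManifold J ∞ N] in
theorem center_mem (x : M) (y : N) : (extChartAt I x x, extChartAt J y y)
    ∈ (extChartAt I x).target ×ˢ (extChartAt J y).target :=
  ⟨mem_extChartAt_target x, mem_extChartAt_target y⟩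

omit [I.Boundaryless] [J.Boundaryless] [IsManifold I ∞ M] [IsManifold J ∞ N] in
theorem extChartAt_prod_self (x : M) (y : N) :
    extChartAt (I.prod J) (x, y) (x, y) = (extChartAt I x x, extChartAt J y y) := by
  rw [extChartAt_prod]
  rfl

theorem comps_warped_eventuallyEq (x : M) (y : N) :
    comps (bE.prod bF) (warped gB gF f) (x, y)
      =ᶠ[nhds (extChartAt I x x, extChartAt J y y)] chartMat bE bF gB gF f x y := by
  filter_upwards [((isOpen_extChartAt_target (I := I) x).prod
    (isOpen_extChartAt_target (I := J) y)).mem_nhds (center_mem x y)] with w hw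
  exact comps_warped bE bF gB gF f (z₀ := (x, y)) hw.1 hw.2

theorem comps₁_basePart_center (x : M) (y : N) (a : ι) :
    comps₁ bE (basePart P y) x a (extChartAt I x x) = centerComps bE bF P x y (Sum.inl a) :=
  comps₁_basePart bE bF P x y (mem_extChartAt_target x) a

theorem comps₁_fiberPart_center (x : M) (y : N) (α : κ) :
    comps₁ bF (fiberPart P x) y α (extChartAt J y y) = centerComps bE bF P x y (Sum.inr α) :=
  comps₁_fiberPart bE bF P x y (mem_extChartAt_target y) α

theorem exists_centerComps_ne_zero {x : M} {y : N} (hP : P (x, y) ≠ 0) :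
    ∃ m, centerComps bE bF P x y m ≠ 0 := by
  obtain ⟨m, hm⟩ := exists_comps₁_ne_zero (bE.prod bF) P hP
  rw [extChartAt_prod_self] at hm
  exact ⟨m, hm⟩

variable [Fintype ι] [DecidableEq ι] [Fintype κ] [DecidableEq κ]

theorem HGKAt.hyperAt {x : M} {y : N} (h : HGKAt (bE.prod bF) (warped gB gF f) P Q (x, y)) :
    HyperAt (bE.prod bF) (chartMat bE bF gB gF f x y) (centerComps bE bF P x y)
      (centerComps bE bF Q x y) (extChartAt I x x, extChartAt J y y) := by
  intro i j k l m
  have e := comps_warped_eventuallyEq (bE := bE) (bF := bF) (gB := gB) (gF := gF) (f := f) x y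
  have h1 := h i j k l m
  rw [extChartAt_prod_self, covRiem_congr _ e, (riem_eventuallyEq _ e _ _ _ _).eq_of_nhds,
    ricci_congr _ e, e.eq_of_nhds] at h1
  exact h1

theorem RecurrentAt.hyperAt {x : M} {y : N}
    (h : RecurrentAt (bE.prod bF) (warped gB gF f) (x, y)) :
    ∃ π : ι ⊕ κ → ℝ, HyperAt (bE.prod bF) (chartMat bE bF gB gF f x y) π 0
      (extChartAt I x x, extChartAt J y y) := by
  obtain ⟨π, hπ⟩ := h
  refine ⟨π, fun i j k l m => ?_⟩
  have e := comps_warped_eventuallyEq (bE := bE) (bF := bF) (gB := gB) (gF := gF) (f := f) x y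
  have h1 := hπ i j k l m
  rw [extChartAt_prod_self, covRiem_congr _ e, (riem_eventuallyEq _ e _ _ _ _).eq_of_nhds] at h1
  rw [h1, Pi.zero_apply, zero_mul, add_zero]

/-- Off $U_M$ recurrence is the identity with $\psi=0$; a conclusion that does not mention the
covectors therefore holds at every point. -/
theorem IsHGK.exists_hyperAt (h : IsHGK (bE.prod bF) (warped gB gF f) P Q) (x : M) (y : N) :
    ∃ π ψ : ι ⊕ κ → ℝ, HyperAt (bE.prod bF) (chartMat bE bF gB gF f x y) π ψ
      (extChartAt I x x, extChartAt J y y) := by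
  by_cases hr : RecurrentAt (bE.prod bF) (warped gB gF f) (x, y)
  · obtain ⟨π, hπ⟩ := hr.hyperAt
    exact ⟨π, 0, hπ⟩
  · exact ⟨_, _, (h.2 _ hr).hyperAt⟩

theorem warpData_chart (hgB : IsMetric bE gB) (hgF : IsMetric bF gF)
    (hf : ContMDiff I 𝓘(ℝ, ℝ) ∞ f) (hf_pos : ∀ x, 0 < f x) (x : M) (y : N) :
    WarpData (comps bE gB x) (comps bF gF y) (f ∘ (extChartAt I x).symm)
      (extChartAt I x).target (extChartAt J y).target where
  base := hgB.smoothMetricOn bE x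
  fiber := hgF.smoothMetricOn bF y
  smooth := contDiffOn_comp_chart_symm hf x
  ne_zero _ _ := (hf_pos _).ne'

variable (hgB : IsMetric bE gB) (hgF : IsMetric bF gF)
    (hf : ContMDiff I 𝓘(ℝ, ℝ) ∞ f) (hf_pos : ∀ x, 0 < f x)
include hgB hgF hf hf_pos

/-- Used by contraposition: over a point where the base is not recurrent, every $(x,y)$ lies in
$U_M$, so (H) is available there. -/
theorem recurrentAt_base {x : M} {y : N}
    (h : RecurrentAt (bE.prod bF) (warped gB gF f) (x, y)) : RecurrentAt bE gB x := by
  obtain ⟨π, hπ⟩ := h.hyperAt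
  refine ⟨fun a => π (Sum.inl a), fun a b c d e => ?_⟩
  simpa using (warpData_chart hgB hgF hf hf_pos x y).base_identity bE bF (center_mem x y) hπ
    a b c d e

theorem recurrentAt_fiber [Nonempty κ] {x : M} {y : N}
    (h : RecurrentAt (bE.prod bF) (warped gB gF f) (x, y)) : RecurrentAt bF gF y := by
  obtain ⟨π, hπ⟩ := h.hyperAt
  exact (warpData_chart hgB hgF hf hf_pos x y).exists_recurrent_fiber bE bF (center_mem x y) hπ

theorem base_HGKAt_of_eq_smul {lam : M → ℝ}
    (hlam : ∀ x₀ : M, ∀ u ∈ (extChartAt I x₀).target,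
      warpT bE (comps bE gB x₀) (f ∘ (extChartAt I x₀).symm) u
        = lam ((extChartAt I x₀).symm u) • ricci bE (comps bE gB x₀) u) {x : M} {y : N}
    (h : HGKAt (bE.prod bF) (warped gB gF f) P Q (x, y)) :
    HGKAt bE gB (basePart P y) (fun x => (1 - Fintype.card κ * lam x) • basePart Q y x) x := by
  intro a b c d e
  have h1 := (warpData_chart hgB hgF hf hf_pos x y).base_identity bE bF (center_mem x y)
    h.hyperAt a b c d e
  rw [hlam x _ (mem_extChartAt_target x)] at h1
  have h2 : comps₁ bE (fun x => (1 - Fintype.card κ * lam x) • basePart Q y x) x e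
      (extChartAt I x x) = (1 - Fintype.card κ * lam ((extChartAt I x).symm (extChartAt I x x)))
        * comps₁ bE (basePart Q y) x e (extChartAt I x x) := rfl
  rw [h1, h2, comps₁_basePart_center (bF := bF), comps₁_basePart_center (bF := bF)]
  simp only [kn, Matrix.sub_apply, Matrix.smul_apply, smul_eq_mul]
  ring

theorem base_HGKAt_of_ricci_eq_zero
    (hS : ∀ x₀ : M, ∀ u ∈ (extChartAt I x₀).target, ricci bE (comps bE gB x₀) u = 0)
    {x : M} {y : N} (h : HGKAt (bE.prod bF) (warped gB gF f) P Q (x, y)) :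
    HGKAt bE gB (basePart P y) (fun _ => 0) x := by
  intro a b c d e
  have h1 := (warpData_chart hgB hgF hf hf_pos x y).base_identity bE bF (center_mem x y) h.hyperAt
  have h2 := (hgB.smoothMetricOn bE x).recurrent_of_ricci_eq_zero bE (mem_extChartAt_target x)
    (hS x) (π := fun a => centerComps bE bF P x y (Sum.inl a))
    (ψ := fun a => centerComps bE bF Q x y (Sum.inl a)) h1 a b c d e
  rw [h2, comps₁_basePart_center (bF := bF)]
  have h3 : comps₁ (I := I) (M := M) bE (fun _ => 0) x e (extChartAt I x x) = 0 := rfl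
  rw [h3, zero_mul, add_zero]

theorem exists_isHGK_base [Nonempty N] (h : IsHGK (bE.prod bF) (warped gB gF f) P Q)
    (hT : TDependsOnRicci bE gB f) :
    ∃ P' Q' : CovectorField I M, IsHGK bE gB P' Q' ∧
      ((∀ z, HGKAt (bE.prod bF) (warped gB gF f) P Q z) → ∀ x, HGKAt bE gB P' Q' x) := by
  obtain ⟨y⟩ := ‹Nonempty N›
  -- One fiber point $y$ serves all $x$. A pointwise transfer of (H) from $(x,y)$ to $x$ yields both
  -- the statement on $U_{\overline M}$ and the global one, with the same forms.
  suffices key : ∃ Q' : CovectorField I M, IsSmoothForm bE Q' ∧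
      ∀ x, HGKAt (bE.prod bF) (warped gB gF f) P Q (x, y) → HGKAt bE gB (basePart P y) Q' x by
    obtain ⟨Q', hs, hQ⟩ := key
    refine ⟨basePart P y, Q', ⟨⟨h.1.1.basePart bE bF y, hs⟩, fun x hx => hQ x (h.2 _ ?_)⟩,
      fun hz x => hQ x (hz _)⟩
    exact fun hr => hx (recurrentAt_base hgB hgF hf hf_pos hr)
  rcases hT with ⟨lam, hsm, hlam⟩ | hS
  · refine ⟨_, fun x₀ a => ?_, fun x hx => base_HGKAt_of_eq_smul hgB hgF hf hf_pos hlam hx⟩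
    exact (contDiffOn_const.sub (contDiffOn_const.mul (contDiffOn_comp_chart_symm hsm x₀))).mul
      (h.1.2.basePart bE bF y x₀ a)
  · exact ⟨fun _ => 0, fun x₀ a => contDiffOn_const,
      fun x hx => base_HGKAt_of_ricci_eq_zero hgB hgF hf hf_pos hS hx⟩

theorem fiber_SGKAt {x : M} {y : N} (h : HGKAt (bE.prod bF) (warped gB gF f) P Q (x, y)) :
    SGKAt bF gF (fiberPart P x) (fun _ => 0) (fiberPart Q x)
      (fun y => (-(1 / 2) * f x * fieldP bE gB f x) • fiberPart P x y
        + fieldQ bE gB f (Fintype.card κ) x • fiberPart Q x y) y := by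
  intro α β γ δ ε
  have h1 := (warpData_chart hgB hgF hf hf_pos x y).fiber_identity bE bF (center_mem x y)
    h.hyperAt α β γ δ ε
  have h2 : comps₁ (I := J) (M := N) bF (fun _ => 0) y ε (extChartAt J y y) = 0 := rfl
  have h3 : comps₁ bF (fun y => (-(1 / 2) * f x * fieldP bE gB f x) • fiberPart P x y
        + fieldQ bE gB f (Fintype.card κ) x • fiberPart Q x y) y ε (extChartAt J y y)
      = (-(1 / 2) * f x * fieldP bE gB f x) * comps₁ bF (fiberPart P x) y ε (extChartAt J y y)
        + fieldQ bE gB f (Fintype.card κ) x * comps₁ bF (fiberPart Q x) y ε (extChartAt J y y) :=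
    rfl
  rw [h1, h2, h3, comps₁_fiberPart_center (bE := bE), comps₁_fiberPart_center (bE := bE)]
  simp only [Function.comp_apply, extChartAt_to_inv, fieldP, fieldQ]
  ring

theorem fiber_isSGK [Nonempty κ] (h : IsHGK (bE.prod bF) (warped gB gF f) P Q) (x : M) :
    IsSGK bF gF (fiberPart P x) (fun _ => 0) (fiberPart Q x)
      (fun y => (-(1 / 2) * f x * fieldP bE gB f x) • fiberPart P x y
        + fieldQ bE gB f (Fintype.card κ) x • fiberPart Q x y) := by
  have hP := h.1.1.fiberPart bE bF x
  have hQ := h.1.2.fiberPart bE bF x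
  refine ⟨⟨hP, fun _ _ => contDiffOn_const, hQ, fun y₀ α => ?_⟩, fun y hy =>
    fiber_SGKAt hgB hgF hf hf_pos (h.2 _ fun hr => hy (recurrentAt_fiber hgB hgF hf hf_pos hr))⟩
  exact (contDiffOn_const.mul (hP y₀ α)).add (contDiffOn_const.mul (hQ y₀ α))

theorem fiber_weylVanishesAt (hcard : 3 ≤ Fintype.card κ) {x : M} {y : N}
    (h : HGKAt (bE.prod bF) (warped gB gF f) P Q (x, y))
    (hne : differential I f x + f x • basePart P y x ≠ 0) : WeylVanishesAt bF gF y := by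
  obtain ⟨a, ha⟩ := exists_comps₁_ne_zero bE
    (fun x => differential I f x + f x • basePart P y x) hne
  have h1 : comps₁ bE (fun x => differential I f x + f x • basePart P y x) x a (extChartAt I x x)
      = comps₁ bE (differential I f) x a (extChartAt I x x)
        + f ((extChartAt I x).symm (extChartAt I x x))
          * comps₁ bE (basePart P y) x a (extChartAt I x x) := rfl
  rw [h1, comps₁_differential bE hf (mem_extChartAt_target x),
    comps₁_basePart_center (bF := bF)] at ha
  obtain ⟨A, hA⟩ := (warpData_chart hgB hgF hf hf_pos x y).exists_riem_eq_kn bE bF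
    (center_mem x y) h.hyperAt ha
  exact (hgF.smoothMetricOn bF y).weyl_eq_zero bF (mem_extChartAt_target y) hcard hA

theorem fiber_einsteinAt [Nonempty ι] {x : M} {y : N}
    (h : HGKAt (bE.prod bF) (warped gB gF f) P Q (x, y)) (hne : Q (x, y) ≠ 0) :
    EinsteinAt bF gF y := by
  obtain ⟨m, hm⟩ := exists_centerComps_ne_zero (bE := bE) (bF := bF) hne
  obtain ⟨c, hc⟩ := (warpData_chart hgB hgF hf hf_pos x y).exists_ricci_eq_smul bE bF
    (center_mem x y) h.hyperAt hm
  exact (hgF.smoothMetricOn bF y).einstein_of_ricci_eq_smul bF (mem_extChartAt_target y) hc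

/-- One base point with $df\neq0$ is kept fixed while $y$ runs through the fiber. The constant is
built from base data at $x$ alone, so neither connectedness nor Schur's lemma is needed. -/
theorem fiber_constantCurvature (h : IsHGK (bE.prod bF) (warped gB gF f) P Q) {x : M}
    (hx : differential I f x ≠ 0) : ConstantCurvature bF gF := by
  obtain ⟨a, ha⟩ := exists_comps₁_ne_zero bE (differential I f) hx
  rw [comps₁_differential bE hf (mem_extChartAt_target x)] at ha
  refine ⟨(f ∘ (extChartAt I x).symm) (extChartAt I x x) * fieldP bE gB f x
    - (f ∘ (extChartAt I x).symm) (extChartAt I x x)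
      * (∑ c, gradComp bE (comps bE gB x) (f ∘ (extChartAt I x).symm) c (extChartAt I x x)
        * warpT bE (comps bE gB x) (f ∘ (extChartAt I x).symm) (extChartAt I x x) a c)
      / pderiv bE a (f ∘ (extChartAt I x).symm) (extChartAt I x x), fun y α β γ δ => ?_⟩
  obtain ⟨π, ψ, hH⟩ := h.exists_hyperAt x y
  exact (warpData_chart hgB hgF hf hf_pos x y).riem_eq_const_mul_kn bE bF (center_mem x y) hH ha
    α β γ δ

end WarpedProduct

end SemiRiem

theorem corollary4p8 (p q : ℕ) (hp : 1 ≤ p) (hq : 1 ≤ q)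
    {B : Type*} [TopologicalSpace B] [ChartedSpace (EuclideanSpace ℝ (Fin p)) B]
    [IsManifold (𝓡 p) ∞ B]
    {N : Type*} [TopologicalSpace N] [ChartedSpace (EuclideanSpace ℝ (Fin q)) N]
    [IsManifold (𝓡 q) ∞ N] [Nonempty N]
    (gB : BilinField (𝓡 p) B)
    (gF : BilinField (𝓡 q) N)
    (hgB : IsMetric (stdBasis p) gB)
    (hgF : IsMetric (stdBasis q) gF)
    (f : B → ℝ) (hf : ContMDiff (𝓡 p) 𝓘(ℝ, ℝ) ∞ f)
    (hf_pos : ∀ x, 0 < f x)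
    (Pi Psi : CovectorField
      ((𝓡 p).prod (𝓡 q)) (B × N))
    (hHGK : IsHGK (prodBasis p q) (warped gB gF f) Pi Psi) :
    -- the base
    (TDependsOnRicci (stdBasis p) gB f →
      ∃ P' Psi' : CovectorField (𝓡 p) B,
        IsHGK (stdBasis p) gB P' Psi' ∧
        ((∀ z, HGKAt (prodBasis p q) (warped gB gF f) Pi Psi z) →
          ∀ x, HGKAt (stdBasis p) gB P' Psi' x)) ∧
    -- the fiber is super generalized recurrent
    (∀ x : B,
      IsSGK (stdBasis q) gF
        (fiberPart Pi x) (fun _ => 0) (fiberPart Psi x)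
        (fun y => (-(1 / 2) * f x * fieldP (stdBasis p) gB f x)
            • fiberPart Pi x y
          + fieldQ (stdBasis p) gB f q x • fiberPart Psi x y) ∧
      ∀ y : N,
        HGKAt (prodBasis p q) (warped gB gF f) Pi Psi (x, y) →
        SGKAt (stdBasis q) gF
          (fiberPart Pi x) (fun _ => 0) (fiberPart Psi x)
          (fun y => (-(1 / 2) * f x * fieldP (stdBasis p) gB f x)
              • fiberPart Pi x y
            + fieldQ (stdBasis p) gB f q x • fiberPart Psi x y) y) ∧
    -- vanishing conformal curvature of the fiber
    (3 ≤ q → ∀ (x : B) (y : N),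
      HGKAt (prodBasis p q) (warped gB gF f) Pi Psi (x, y) →
      differential (𝓡 p) f x + f x • basePart Pi y x ≠ 0 →
      WeylVanishesAt (stdBasis q) gF y) ∧
    -- Einstein condition and constant curvature of the fiber
    (∀ (x : B) (y : N),
      HGKAt (prodBasis p q) (warped gB gF f) Pi Psi (x, y) →
      Psi (x, y) ≠ 0 →
      EinsteinAt (stdBasis q) gF y) ∧
    ((∃ x : B, differential (𝓡 p) f x ≠ 0) →
      ConstantCurvature (stdBasis q) gF) := by
  -- Positive dimensions provide a nonzero entry of $\overline g$ (Einstein condition) and of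
  -- $\widetilde g$ (recurrence of the fiber).
  have : Nonempty (Fin p) := ⟨⟨0, hp⟩⟩
  have : Nonempty (Fin q) := ⟨⟨0, hq⟩⟩
  refine ⟨fun hT => exists_isHGK_base hgB hgF hf hf_pos hHGK hT, fun x => ⟨?_, fun y hy => ?_⟩,
    fun hq3 x y hy hne => fiber_weylVanishesAt hgB hgF hf hf_pos (by simpa using hq3) hy hne,
    fun x y hy hne => fiber_einsteinAt hgB hgF hf hf_pos hy hne,
    fun ⟨x, hx⟩ => fiber_constantCurvature hgB hgF hf hf_pos hHGK hx⟩
  · simpa only [Fintype.card_fin] using fiber_isSGK hgB hgF hf hf_pos hHGK x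
  · simpa only [Fintype.card_fin] using fiber_SGKAt hgB hgF hf hf_pos hy
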